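/- \textbf{Theorem (monodromy of polylogarithms).} Let $s\in\mathbb C$ with $\operatorname{Re} s>1$, and for $|w|<1$ let $\mathrm{Li}_s(w)=\sum_{n\ge 1} w^n/n^s$. Let $D^*=\{z\in\mathbb C : |z|<1\}\setminus(-1,0]$. On $D^*$ let $\log$ be the principal logarithm, and let $$(\log z)^{s-1}=e^{(s-1)\,\ell(z)},\qquad e^{\ell(z)}=\log z,\quad \operatorname{Im}\ell(z)\in(\tfrac{\pi}{2},\tfrac{3\pi}{2})$$ (for $\operatorname{Im} z\ge 0$ this is the principal power of $\log z$). For 1-forms $\alpha,\beta$ and a path $\gamma$ parametrized by $[0,1]$, put, whenever the integrals converge, $$\int_\gamma \alpha\,\beta^{s-1}=\int_0^1\frac{1}{\Gamma(s)}\Bigl(\int_t^1\gamma^*\beta\Bigr)^{s-1}\gamma^*\alpha(t),\qquad \int_\gamma\beta^{s-1}=\frac{1}{\Gamma(s)}\Bigl(\int_\gamma\beta\Bigr)^{s-1},$$ and write $[a\to b]$ for the straight path from $a$ to $b$. Let $w\in D^*$ and let $\gamma$ be a piecewise $C^1$ loop based at $w$ in $\mathbb C\setminus\{0,1\}$ about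 $1$, i.e. $\gamma$ is homotopic in $\mathbb C\setminus\{0,1\}$, with fixed end points, to the loop that goes straight from $w$ to $1-\varepsilon$ for some $0<\varepsilon<1$, then once counterclockwise around the circle of radius $\varepsilon$ about $1$, then straight back to $w$. Then the germ of $\mathrm{Li}_s$ at $w$ has an analytic continuation along $\gamma$, and every such continuation ends in the germ at $w$ of $$z\longmapsto \mathrm{Li}_s(z)-\frac{2\pi i}{\Gamma(s)}(\log z)^{s-1}.$$ Moreover, for every $z\in D^*$ the following integrals converge and $$\mathrm{Li}_s(z)-\frac{2\pi i}{\Gamma(s)}(\log z)^{s-1}=\int_{[0\to z]}\frac{dx}{1-x}\Bigl(\frac{dx}{x}\Bigr)^{s-1}+\int_\gamma\frac{dx}{1-x}\cdot\int_{[1\to z]}\Bigl(\frac{dx}{x}\Bigr)^{s-1}.$$ Here the power in the first integral on the right is the principal one (its base $\int_t^1 dx/x$ along $[0\to z]$ is the positive number $-\log t$, $0<t<1$), and in $\int_{[1\to z]}(dx/x)^{s-1}=\frac{1}{\Gamma(s)}(\int_{[1\to z]}dx/x)^{s-1}$ the power is the branch $(\log z)^{s-1}$ above. -/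

import Mathlib

open scoped Topology unitInterval

noncomputable section

/-- The polylogarithm `Li_s(w) = ∑_{n ≥ 1} w ^ n / n ^ s` (convergent for `|w| < 1`). -/
def polylog (s w : ℂ) : ℂ := ∑' n : ℕ, w ^ (n + 1) / ((n + 1 : ℕ) : ℂ) ^ s

/-- The determination of the logarithm whose imaginary part lies in `(θ - π, θ + π]`. -/
def logDet (θ : ℝ) (z : ℂ) : ℂ :=
  Complex.log (z * Complex.exp (-(θ * Complex.I))) + θ * Complex.I

/-- The complex power `z ^ a = exp (a * log z)` for the determination `logDet θ` of the logarithm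
(for `θ = 0` and `z ≠ 0` this is the principal power). -/
def powDet (θ : ℝ) (z a : ℂ) : ℂ := Complex.exp (a * logDet θ z)

/-- The 1-form `dx / x` on `ℂ ∖ {0}`. -/
def formDlog (x : ℂ) : ℂ →L[ℂ] ℂ := x⁻¹ • (1 : ℂ →L[ℂ] ℂ)

/-- The 1-form `dx / (1 - x)` on `ℂ ∖ {1}`. -/
def formOne (x : ℂ) : ℂ →L[ℂ] ℂ := (1 - x)⁻¹ • (1 : ℂ →L[ℂ] ℂ)

/-- The integrand `(1 / Γ(s)) (∫_t^1 γ^*β)^(s-1) γ^*α(t)` of the complex iterated integral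
`∫_γ α β^(s-1)`; the power is taken with the determination `logDet θ` of the logarithm. -/
def iterIntegrand (θ : ℝ) (α β : ℂ → ℂ →L[ℂ] ℂ) {a b : ℂ} (γ : Path a b) (s : ℂ) (t : ℝ) : ℂ :=
  1 / Complex.Gamma s * powDet θ (∫ u in t..1, curveIntegralFun β γ u) (s - 1) *
    curveIntegralFun α γ t

/-- Convergence of the complex iterated integral `∫_γ α β^(s-1)`. -/
def IterIntegrable (θ : ℝ) (α β : ℂ → ℂ →L[ℂ] ℂ) {a b : ℂ} (γ : Path a b) (s : ℂ) : Prop :=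
  (∀ t ∈ Set.Ioo (0 : ℝ) 1, IntervalIntegrable (curveIntegralFun β γ) MeasureTheory.volume t 1) ∧
    IntervalIntegrable (iterIntegrand θ α β γ s) MeasureTheory.volume 0 1

/-- The complex iterated integral
`∫_γ α β^(s-1) = ∫_0^1 (1 / Γ(s)) (∫_t^1 γ^*β)^(s-1) γ^*α(t)`. -/
def iterIntegral (θ : ℝ) (α β : ℂ → ℂ →L[ℂ] ℂ) {a b : ℂ} (γ : Path a b) (s : ℂ) : ℂ :=
  ∫ t in (0 : ℝ)..1, iterIntegrand θ α β γ s t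

/-- The complex iterated integral `∫_γ β^(s-1) = (1 / Γ(s)) (∫_γ β)^(s-1)`. -/
def powIntegral (θ : ℝ) (β : ℂ → ℂ →L[ℂ] ℂ) {a b : ℂ} (γ : Path a b) (s : ℂ) : ℂ :=
  1 / Complex.Gamma s * powDet θ (curveIntegral β γ) (s - 1)

/-- A piecewise continuously differentiable path. -/
def IsPiecewiseC1 {a b : ℂ} (γ : Path a b) : Prop :=
  ∃ (n : ℕ) (τ : ℕ → ℝ), StrictMono τ ∧ τ 0 = 0 ∧ τ n = 1 ∧
    ∀ i < n, ContDiffOn ℝ 1 γ.extend (Set.Icc (τ i) (τ (i + 1)))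

/-- The circle of radius `ε` about `1`, based at `1 - ε`, run through once counterclockwise. -/
def circleAboutOne (ε : ℝ) : Path (1 - ε : ℂ) (1 - ε : ℂ) where
  toFun t := 1 - ε * Complex.exp (2 * Real.pi * (t : ℝ) * Complex.I)
  continuous_toFun := by fun_prop
  source' := by simp
  target' := by simp [Complex.exp_two_pi_mul_I]

/-- The loop `[w → 1 - ε] · (circle of radius ε about 1) · [1 - ε → w]`. -/
def standardLoop (w : ℂ) (ε : ℝ) : Path w w :=
  ((Path.segment w (1 - ε : ℂ)).trans (circleAboutOne ε)).trans (Path.segment (1 - ε : ℂ) w)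

/-- `γ` is a loop about `1` in `ℂ ∖ {0, 1}`: it is homotopic there, with fixed end points, to the
loop which goes straight from `w` to a point `1 - ε` with `0 < ε < 1`, then once counterclockwise
around `1`, and straight back to `w`. -/
def IsLoopAboutOne {w : ℂ} (γ : Path w w) : Prop :=
  ∃ ε ∈ Set.Ioo (0 : ℝ) 1, ∃ H : γ.Homotopy (standardLoop w ε), ∀ p, H p ≠ 0 ∧ H p ≠ 1

/-- `g` is an analytic continuation along `γ`: a family of germs `g t` of analytic functions at the
points `γ t`, such that for `t'` near `t` the germ `g t'` is the one given by `g t` at `γ t'`. -/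
def IsAnalyticContinuationAlong {a b : ℂ} (γ : Path a b) (g : I → ℂ → ℂ) : Prop :=
  (∀ t, AnalyticAt ℂ (g t) (γ t)) ∧ ∀ t, ∀ᶠ t' in 𝓝 t, g t' =ᶠ[𝓝 (γ t')] g t

end

/-! For `|z| < 1` the substitution `t = e^{-x}` gives `Li_s(z) = Γ(s)⁻¹ ∫_0^1 ψ(t) z/(1 - tz) dt`
with `ψ(t) = (-log t)^{s-1}`, and the right side is holomorphic off `[1,∞)`. In the variable `ζ =
1/z` it is a Cauchy integral of `ψ` over `(0,1)`. Replacing `ψ(t)` by `ψ(ζ) - (ψ(ζ) - ψ(t))` splits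
it into an integral of difference quotients, holomorphic across the cut, and `ψ(ζ)(log ζ - log(ζ -
1))` (`polylogRight_eq_of_im_ne_zero`). Only `log(ζ - 1)` jumps on `(0,1)`, by `2πi`, so crossing
`[1,∞)` costs `2πi/Γ(s)` times a branch of `(log z)^{s-1}`. The standard loop crosses it once,
upwards; this gives its continuation explicitly, in three pieces.

A homotopy to another loop may wander anywhere in `ℂ ∖ {0,1}`. One therefore works with the class of
germs of `Li_s` plus linear combinations of branches of `(log z)^{s-1}`: on a disc in `ℂ ∖ {0,1}`
every branch of `log z` is free of zeros, hence has a logarithm, so the class extends locally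
(`extendsLocally_isPolylogGerm`). The monodromy theorem
`ExtendsLocally.exists_continuation_of_homotopy` then transports the continuation to `γ`, and
`IsAnalyticContinuationAlong.eventuallyEq` makes it unique.

The same scheme for logarithms of `1 - z` gives `∫_γ dx/(1-x) = -2πi`. The integrals along segments
are the integral representation above and `log z`. -/

open MeasureTheory

/-! ### Analytic continuation along paths and the monodromy theorem. -/

/-- Germs in the class `P` extend, within the class, to discs whose radius depends only on the
centre. -/
def ExtendsLocally (P : ℂ → (ℂ → ℂ) → Prop) (X : Set ℂ) : Prop :=
  ∀ a ∈ X, ∃ r > 0, ∀ b ∈ Metric.ball a r, ∀ f, P b f →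
    ∃ F : ℂ → ℂ, DifferentiableOn ℂ F (Metric.ball a r) ∧ F =ᶠ[𝓝 b] f ∧
      ∀ c ∈ Metric.ball a r, P c F

/-- Compactness makes the radius of extension uniform: `ρ` is a Lebesgue number of the cover of `K`
by the given discs. The extensions of the germs `g t` to the discs of radius `ρ` about `γ t` then
serve every path that is `ρ`-close to `γ`. -/
theorem ExtendsLocally.exists_continuation_of_dist_lt {P : ℂ → (ℂ → ℂ) → Prop} {X K : Set ℂ}
    (hP : ExtendsLocally P X) (hK : IsCompact K) (hKX : K ⊆ X) :
    ∃ ρ > 0, ∀ {a b : ℂ} (γ γ' : Path a b), (∀ t, γ t ∈ K) → (∀ t, dist (γ' t) (γ t) < ρ) →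
      ∀ g, IsAnalyticContinuationAlong γ g → (∀ t, P (γ t) (g t)) →
        ∃ g', IsAnalyticContinuationAlong γ' g' ∧ (∀ t, P (γ' t) (g' t)) ∧
          g' 0 =ᶠ[𝓝 a] g 0 ∧ g' 1 =ᶠ[𝓝 b] g 1 := by
  choose! r hr0 hr using hP
  obtain ⟨ρ, hρ, hball⟩ := lebesgue_number_lemma_of_metric (c := fun x : X => Metric.ball x.1 (r x))
    hK (fun _ => Metric.isOpen_ball) (fun x hx => Set.mem_iUnion.2
      ⟨⟨x, hKX hx⟩, Metric.mem_ball_self (hr0 x (hKX hx))⟩)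
  refine ⟨ρ, hρ, fun {a b} γ γ' hγK hdist g hg hgP => ?_⟩
  have key : ∀ t, ∃ F : ℂ → ℂ, DifferentiableOn ℂ F (Metric.ball (γ t) ρ) ∧
      F =ᶠ[𝓝 (γ t)] g t ∧ ∀ c ∈ Metric.ball (γ t) ρ, P c F := by
    intro t
    obtain ⟨x, hx⟩ := hball (γ t) (hγK t)
    obtain ⟨F, h1, h2, h3⟩ := hr x x.2 (γ t) (hx (Metric.mem_ball_self hρ)) (g t) (hgP t)
    exact ⟨F, h1.mono hx, h2, fun c hc => h3 c (hx hc)⟩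
  choose G hGd hGg hGP using key
  have han : ∀ t, AnalyticOnNhd ℂ (G t) (Metric.ball (γ t) ρ) := fun t =>
    (hGd t).analyticOnNhd Metric.isOpen_ball
  refine ⟨G, ⟨fun t => han t _ (hdist t), fun t => ?_⟩, fun t => hGP t _ (hdist t), ?_, ?_⟩
  · have e1 : ∀ᶠ t' in 𝓝 t, γ t' ∈ Metric.ball (γ t) ρ :=
      γ.continuous.continuousAt (Metric.ball_mem_nhds _ hρ)
    have e2 : ∀ᶠ t' in 𝓝 t, γ' t' ∈ Metric.ball (γ t) ρ :=
      γ'.continuous.continuousAt (Metric.isOpen_ball.mem_nhds (hdist t))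
    have e3 : ∀ᶠ t' in 𝓝 t, ∀ᶠ z in 𝓝 (γ t'), G t z = g t z :=
      γ.continuous.continuousAt.eventually (hGg t).eventually_nhds
    filter_upwards [e1, e2, e3, hg.2 t] with t' h1 h2 h3 h4
    -- Two discs meet in a convex set, so agreement near `γ t'` spreads to `γ' t'` by the identity
    -- theorem.
    have hpre : IsPreconnected (Metric.ball (γ t) ρ ∩ Metric.ball (γ t') ρ) :=
      ((convex_ball _ _).inter (convex_ball _ _)).isPreconnected
    have heq : G t' =ᶠ[𝓝 (γ t')] G t :=
      (hGg t').trans (h4.trans (Filter.EventuallyEq.symm h3))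
    have := ((han t').mono Set.inter_subset_right).eqOn_of_preconnected_of_eventuallyEq
      ((han t).mono Set.inter_subset_left) hpre ⟨h1, Metric.mem_ball_self hρ⟩ heq
    exact this.eventuallyEq_of_mem
      ((Metric.isOpen_ball.inter Metric.isOpen_ball).mem_nhds ⟨h2, hdist t'⟩)
  · simpa using hGg 0
  · simpa using hGg 1

/-- Monodromy theorem: for a class of germs which extends locally, continuation within the class is
invariant under homotopies of paths. -/
theorem ExtendsLocally.exists_continuation_of_homotopy {P : ℂ → (ℂ → ℂ) → Prop} {X : Set ℂ}
    (hP : ExtendsLocally P X) {a b : ℂ} {γ δ : Path a b} (H : γ.Homotopy δ) (hH : ∀ p, H p ∈ X)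
    {g : I → ℂ → ℂ} (hg : IsAnalyticContinuationAlong δ g) (hgP : ∀ t, P (δ t) (g t)) :
    ∃ g', IsAnalyticContinuationAlong γ g' ∧ (∀ t, P (γ t) (g' t)) ∧
      g' 0 =ᶠ[𝓝 a] g 0 ∧ g' 1 =ᶠ[𝓝 b] g 1 := by
  obtain ⟨ρ, hρ, hcont⟩ := hP.exists_continuation_of_dist_lt (K := Set.range H)
    (isCompact_range H.continuous) (by rintro _ ⟨p, rfl⟩; exact hH p)
  obtain ⟨η, hη, hunif⟩ := Metric.uniformContinuous_iff.1
    (CompactSpace.uniformContinuous_of_continuous H.continuous) ρ hρ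
  -- Connectedness in the homotopy parameter: the step length `η` does not depend on `u`, so both
  -- `S` and its complement are open. The start is `u = 1`, where the path is `δ`.
  set S : Set I := {u | ∃ g', IsAnalyticContinuationAlong (H.eval u) g' ∧
    (∀ t, P (H.eval u t) (g' t)) ∧ g' 0 =ᶠ[𝓝 a] g 0 ∧ g' 1 =ᶠ[𝓝 b] g 1} with hS
  have step : ∀ u v, dist u v < η → u ∈ S → v ∈ S := by
    rintro u v huv ⟨g₁, h1, h2, h3, h4⟩
    obtain ⟨g₂, k1, k2, k3, k4⟩ := hcont (H.eval u) (H.eval v) (fun t => ⟨(u, t), rfl⟩)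
      (fun t => hunif (by
        rw [Prod.dist_eq]; simpa [dist_comm v u, hη] using huv)) g₁ h1 h2
    exact ⟨g₂, k1, k2, k3.trans h3, k4.trans h4⟩
  have hclopen : IsClopen S := by
    refine ⟨⟨Metric.isOpen_iff.2 fun u hu => ⟨η, hη, fun v hv hvS => hu (step v u hv hvS)⟩⟩,
      Metric.isOpen_iff.2 fun u hu => ⟨η, hη, fun v hv => step u v (by rwa [dist_comm]) hu⟩⟩
  have h1 : (1 : I) ∈ S := by
    refine ⟨g, ?_, ?_, .rfl, .rfl⟩
    · simpa using hg
    · simpa using hgP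
  have h0 : (0 : I) ∈ S := by
    rw [hclopen.eq_univ ⟨1, h1⟩]; trivial
  simpa [hS] using h0

/-- The times at which the two germs agree form a clopen set. It is closed because germs that differ
at `γ t` differ on a whole punctured neighbourhood, hence at all nearby times too. -/
theorem IsAnalyticContinuationAlong.eventuallyEq {a b : ℂ} {γ : Path a b} {g g' : I → ℂ → ℂ}
    (hg : IsAnalyticContinuationAlong γ g) (hg' : IsAnalyticContinuationAlong γ g')
    (h0 : g 0 =ᶠ[𝓝 a] g' 0) (t : I) : g t =ᶠ[𝓝 (γ t)] g' t := by
  set S : Set I := {t | g t =ᶠ[𝓝 (γ t)] g' t}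
  have hnear : ∀ t, ∀ᶠ t' in 𝓝 t, (t' ∈ S ↔ g t =ᶠ[𝓝 (γ t')] g' t) := fun t => by
    filter_upwards [hg.2 t, hg'.2 t] with t' h1 h2
    exact ⟨fun h => h1.symm.trans (h.trans h2), fun h => h1.trans (h.trans h2.symm)⟩
  have hclopen : IsClopen S := by
    refine ⟨⟨isOpen_iff_mem_nhds.2 fun t ht => ?_⟩, isOpen_iff_mem_nhds.2 fun t ht => ?_⟩
    · have hne := ((hg.1 t).eventually_eq_or_eventually_ne (hg'.1 t)).resolve_left ht
      rw [eventually_nhdsWithin_iff] at hne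
      filter_upwards [hnear t, γ.continuous.continuousAt.eventually hne.eventually_nhds]
        with t' h1 h2 h3
      have h5 : ∀ᶠ z in 𝓝 (γ t'), z = γ t := by
        filter_upwards [h2, h1.1 h3] with z h4 h5
        by_contra h6
        exact h4 h6 h5
      have h6 : γ t' = γ t := h5.self_of_nhds
      have : ∀ᶠ z in 𝓝[≠] (γ t), z = γ t := (h6 ▸ h5).filter_mono nhdsWithin_le_nhds
      obtain ⟨z, h7, h8⟩ := (this.and self_mem_nhdsWithin).exists
      exact h8 h7
    · filter_upwards [hnear t, γ.continuous.continuousAt.eventually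
        (Filter.Eventually.eventually_nhds ht)] with t' h1 h2
      exact h1.2 h2
  have : t ∈ S := by
    rw [hclopen.eq_univ ⟨0, by simpa [S] using h0⟩]; trivial
  exact this

/-! ### Geometry of the standard loop and continuation in three pieces. -/

/-- The complement of `[1, ∞)`. -/
def cutRight : Set ℂ := {z | 1 - z ∈ Complex.slitPlane}

/-- The complement of `(-∞, 1]`. -/
def cutLeft : Set ℂ := {z | z - 1 ∈ Complex.slitPlane}

theorem mem_cutRight {z : ℂ} : z ∈ cutRight ↔ z.re < 1 ∨ z.im ≠ 0 := by
  simp [cutRight, Complex.mem_slitPlane_iff]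

theorem mem_cutLeft {z : ℂ} : z ∈ cutLeft ↔ 1 < z.re ∨ z.im ≠ 0 := by
  simp [cutLeft, Complex.mem_slitPlane_iff]

theorem isOpen_cutRight : IsOpen cutRight :=
  Complex.isOpen_slitPlane.preimage (by fun_prop)

theorem isOpen_cutLeft : IsOpen cutLeft :=
  Complex.isOpen_slitPlane.preimage (by fun_prop)

theorem mem_cutRight_of_norm_lt_one {z : ℂ} (hz : ‖z‖ < 1) : z ∈ cutRight :=
  mem_cutRight.2 (.inl ((Complex.re_le_norm z).trans_lt hz))

theorem mem_cutRight_or_mem_cutLeft {z : ℂ} (hz : z ≠ 1) : z ∈ cutRight ∨ z ∈ cutLeft := by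
  rw [mem_cutRight, mem_cutLeft]
  by_contra! h
  exact hz (Complex.ext (le_antisymm h.2.1 h.1.1) h.1.2)

/-- The nesting of `Path.trans` puts the first segment on `[0, 1/4]`, the circle on `[1/4, 1/2]` and
the return on `[1/2, 1]`. -/
theorem standardLoop_apply_of_le {w : ℂ} {ε : ℝ} {t : I} (ht : (t : ℝ) ≤ 1 / 4) :
    standardLoop w ε t = w + (4 * t : ℝ) * (1 - ε - w) := by
  have h2 : (t : ℝ) ≤ 1 / 2 := by linarith
  have h3 : 2 * (t : ℝ) ≤ 1 / 2 := by linarith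
  simp only [standardLoop, Path.trans_apply, h2, h3, dif_pos, Path.segment_apply,
    AffineMap.lineMap_apply_module', Complex.real_smul]
  push_cast
  ring

theorem standardLoop_apply_of_mem {w : ℂ} {ε : ℝ} {t : I} (ht : (1 / 4 : ℝ) ≤ t)
    (ht' : (t : ℝ) ≤ 1 / 2) : standardLoop w ε t =
      1 - ε * Complex.exp ((2 * Real.pi * (4 * t - 1) : ℝ) * Complex.I) := by
  rcases ht.eq_or_lt with h | h
  · rw [standardLoop_apply_of_le h.ge, ← h]
    norm_num
  · have h3 : ¬ 2 * (t : ℝ) ≤ 1 / 2 := by linarith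
    simp only [standardLoop, Path.trans_apply, ht', h3, dif_pos, dif_neg, not_false_iff,
      circleAboutOne]
    simp only [Path.coe_mk_mk]
    push_cast
    ring_nf

theorem standardLoop_apply_of_ge {w : ℂ} {ε : ℝ} {t : I} (ht : (1 / 2 : ℝ) ≤ t) :
    standardLoop w ε t = w + (2 - 2 * t : ℝ) * (1 - ε - w) := by
  rcases ht.eq_or_lt with h | h
  · rw [standardLoop_apply_of_mem (by linarith) h.ge, ← h]
    norm_num [Complex.exp_two_pi_mul_I]
  · have h3 : ¬ (t : ℝ) ≤ 1 / 2 := by linarith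
    simp only [standardLoop, Path.trans_apply, h3, dif_neg, not_false_iff, Path.segment_apply,
      AffineMap.lineMap_apply_module', Complex.real_smul]
    push_cast
    ring

theorem segment_mem_inter {w : ℂ} (hw : ‖w‖ < 1) (hw' : w ∈ Complex.slitPlane) {ε : ℝ}
    (hε : ε ∈ Set.Ioo (0 : ℝ) 1) {r : ℝ} (hr : r ∈ Set.Icc (0 : ℝ) 1) :
    w + (r : ℝ) * (1 - ε - w) ∈ cutRight ∩ Complex.slitPlane := by
  have h1 := (Complex.re_le_norm w).trans_lt hw
  obtain ⟨hε0, hε1⟩ := hε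
  obtain ⟨hr0, hr1⟩ := hr
  simp only [Set.mem_inter_iff, mem_cutRight, Complex.mem_slitPlane_iff, Complex.add_re,
    Complex.add_im, Complex.mul_re, Complex.mul_im, Complex.sub_re, Complex.sub_im,
    Complex.ofReal_re, Complex.ofReal_im, Complex.one_re, Complex.one_im] at hw' ⊢
  constructor
  · left
    rcases hr0.eq_or_lt with rfl | hr0
    · linarith
    · nlinarith [mul_pos hr0 hε0, mul_nonneg (sub_nonneg.2 hr1) (sub_pos.2 h1).le]
  · rcases hr1.eq_or_lt with rfl | hr1
    · left; nlinarith
    · rcases hw' with h | h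
      · left; nlinarith
      · right
        have : w.im + (r * (0 - 0 - w.im) + 0 * (1 - ε - w.re)) = (1 - r) * w.im := by ring
        rw [this]
        exact mul_ne_zero (by linarith) h

theorem circle_re_im (ε θ : ℝ) : (1 - ε * Complex.exp (θ * Complex.I)).re = 1 - ε * Real.cos θ ∧
    (1 - ε * Complex.exp (θ * Complex.I)).im = -(ε * Real.sin θ) := by
  simp [Complex.exp_ofReal_mul_I_re, Complex.exp_ofReal_mul_I_im]

/-- The times `5/16` and `7/16` are a quarter and three quarters of the way round the circle, at `1
- iε` and `1 + iε`. Only between them does the loop meet `[1,∞)`, and there it avoids `(-∞,1]`. -/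
theorem standardLoop_mem_of_le {w : ℂ} (hw : ‖w‖ < 1) (hw' : w ∈ Complex.slitPlane) {ε : ℝ}
    (hε : ε ∈ Set.Ioo (0 : ℝ) 1) {t : I} (ht : (t : ℝ) ≤ 5 / 16) :
    standardLoop w ε t ∈ cutRight ∩ Complex.slitPlane := by
  rcases le_total (t : ℝ) (1 / 4) with h | h
  · rw [standardLoop_apply_of_le h]
    exact segment_mem_inter hw hw' hε ⟨by linarith [t.2.1], by linarith⟩
  · rw [standardLoop_apply_of_mem h (by linarith)]
    obtain ⟨e1, e2⟩ := circle_re_im ε (2 * Real.pi * (4 * t - 1))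
    have hpi := Real.pi_pos
    rw [Set.mem_inter_iff, mem_cutRight, Complex.mem_slitPlane_iff, e1, e2]
    refine ⟨?_, .inl ?_⟩
    · rcases h.eq_or_lt with h | h
      · left
        rw [← h]; norm_num; exact hε.1
      · right
        refine neg_ne_zero.2 (mul_pos hε.1 (Real.sin_pos_of_pos_of_lt_pi ?_ ?_)).ne'
        · have : 0 < 4 * (t : ℝ) - 1 := by linarith
          positivity
        · nlinarith
    · nlinarith [Real.cos_le_one (2 * Real.pi * (4 * t - 1)), hε.1, hε.2]

theorem standardLoop_mem_of_ge {w : ℂ} (hw : ‖w‖ < 1) (hw' : w ∈ Complex.slitPlane) {ε : ℝ}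
    (hε : ε ∈ Set.Ioo (0 : ℝ) 1) {t : I} (ht : (7 / 16 : ℝ) ≤ t) :
    standardLoop w ε t ∈ cutRight ∩ Complex.slitPlane := by
  rcases le_total (t : ℝ) (1 / 2) with h | h
  · rw [standardLoop_apply_of_mem (by linarith) h]
    obtain ⟨e1, e2⟩ := circle_re_im ε (2 * Real.pi * (4 * t - 1))
    have hpi := Real.pi_pos
    rw [Set.mem_inter_iff, mem_cutRight, Complex.mem_slitPlane_iff, e1, e2]
    refine ⟨?_, .inl ?_⟩
    · rcases h.eq_or_lt with h | h
      · left
        rw [h]; norm_num; exact hε.1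
      · right
        refine neg_ne_zero.2 (mul_neg_of_pos_of_neg hε.1 ?_).ne
        rw [← Real.sin_sub_two_pi]
        apply Real.sin_neg_of_neg_of_neg_pi_lt
        · nlinarith
        · nlinarith
    · nlinarith [Real.cos_le_one (2 * Real.pi * (4 * t - 1)), hε.1, hε.2]
  · rw [standardLoop_apply_of_ge h]
    exact segment_mem_inter hw hw' hε ⟨by linarith [t.2.2], by linarith⟩

theorem standardLoop_mem_cutLeft {w : ℂ} {ε : ℝ} (hε : ε ∈ Set.Ioo (0 : ℝ) 1) {t : I}
    (ht : (5 / 16 : ℝ) ≤ t) (ht' : (t : ℝ) ≤ 7 / 16) : standardLoop w ε t ∈ cutLeft := by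
  rw [standardLoop_apply_of_mem (by linarith) (by linarith)]
  obtain ⟨e1, e2⟩ := circle_re_im ε (2 * Real.pi * (4 * t - 1))
  have hpi := Real.pi_pos
  rw [mem_cutLeft, e1, e2]
  by_cases hs : Real.sin (2 * Real.pi * (4 * t - 1)) = 0
  · left
    have hc : Real.cos (2 * Real.pi * (4 * t - 1)) ≤ 0 :=
      Real.cos_nonpos_of_pi_div_two_le_of_le (by nlinarith) (by nlinarith)
    have h1 := Real.sin_sq_add_cos_sq (2 * Real.pi * (4 * t - 1))
    have h2 : Real.cos (2 * Real.pi * (4 * t - 1)) ≠ 0 := fun h => by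
      rw [hs, h] at h1; norm_num at h1
    nlinarith [hε.1, mul_neg_of_pos_of_neg hε.1 (hc.lt_of_ne h2)]
  · right
    exact neg_ne_zero.2 (mul_ne_zero hε.1.ne' hs)

theorem standardLoop_im_neg {w : ℂ} {ε : ℝ} (hε : ε ∈ Set.Ioo (0 : ℝ) 1) {t : I}
    (ht : (t : ℝ) = 5 / 16) : (standardLoop w ε t).im < 0 := by
  rw [standardLoop_apply_of_mem (by linarith) (by linarith), (circle_re_im ε _).2, ht,
    show 2 * Real.pi * (4 * (5 / 16) - 1) = Real.pi / 2 by ring, Real.sin_pi_div_two]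
  linarith [hε.1]

theorem standardLoop_im_pos {w : ℂ} {ε : ℝ} (hε : ε ∈ Set.Ioo (0 : ℝ) 1) {t : I}
    (ht : (t : ℝ) = 7 / 16) : 0 < (standardLoop w ε t).im := by
  rw [standardLoop_apply_of_mem (by linarith) (by linarith), (circle_re_im ε _).2, ht,
    show 2 * Real.pi * (4 * (7 / 16) - 1) = Real.pi / 2 + Real.pi by ring, Real.sin_add_pi,
    Real.sin_pi_div_two]
  linarith [hε.1]

/-- The family of germs which is constantly `F₁`, then `F₂`, then `F₃` along `standardLoop`. -/
noncomputable def threePieces (F₁ F₂ F₃ : ℂ → ℂ) (t : I) : ℂ → ℂ :=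
  if (t : ℝ) ≤ 5 / 16 then F₁ else if (t : ℝ) ≤ 7 / 16 then F₂ else F₃

theorem threePieces_zero (F₁ F₂ F₃ : ℂ → ℂ) : threePieces F₁ F₂ F₃ 0 = F₁ := by
  norm_num [threePieces]

theorem threePieces_one (F₁ F₂ F₃ : ℂ → ℂ) : threePieces F₁ F₂ F₃ 1 = F₃ := by
  norm_num [threePieces]

theorem threePieces_induction {F₁ F₂ F₃ : ℂ → ℂ} {w : ℂ} (hw : ‖w‖ < 1)
    (hw' : w ∈ Complex.slitPlane) {ε : ℝ} (hε : ε ∈ Set.Ioo (0 : ℝ) 1) {P : ℂ → (ℂ → ℂ) → Prop}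
    (h1 : ∀ z ∈ cutRight ∩ Complex.slitPlane, P z F₁) (h2 : ∀ z ∈ cutLeft, P z F₂)
    (h3 : ∀ z ∈ cutRight ∩ Complex.slitPlane, P z F₃) (t : I) :
    P (standardLoop w ε t) (threePieces F₁ F₂ F₃ t) := by
  unfold threePieces
  split_ifs with h h'
  · exact h1 _ (standardLoop_mem_of_le hw hw' hε h)
  · exact h2 _ (standardLoop_mem_cutLeft hε (not_le.1 h).le h')
  · exact h3 _ (standardLoop_mem_of_ge hw hw' hε (not_le.1 h').le)

/-- At the two switching times the loop is strictly below, respectively strictly above, the real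
axis, so agreement of consecutive functions on one open half plane suffices. -/
theorem isAnalyticContinuationAlong_threePieces {F₁ F₂ F₃ : ℂ → ℂ} {w : ℂ} (hw : ‖w‖ < 1)
    (hw' : w ∈ Complex.slitPlane) {ε : ℝ} (hε : ε ∈ Set.Ioo (0 : ℝ) 1)
    (h1 : ∀ z ∈ cutRight ∩ Complex.slitPlane, AnalyticAt ℂ F₁ z)
    (h2 : ∀ z ∈ cutLeft, AnalyticAt ℂ F₂ z)
    (h3 : ∀ z ∈ cutRight ∩ Complex.slitPlane, AnalyticAt ℂ F₃ z)
    (h12 : ∀ z : ℂ, z.im < 0 → F₁ z = F₂ z) (h23 : ∀ z : ℂ, 0 < z.im → F₂ z = F₃ z) :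
    IsAnalyticContinuationAlong (standardLoop w ε) (threePieces F₁ F₂ F₃) := by
  refine ⟨threePieces_induction (P := fun z f => AnalyticAt ℂ f z) hw hw' hε h1 h2 h3, fun t => ?_⟩
  have hcoe : Continuous (fun t : I => (t : ℝ)) := continuous_subtype_val
  rcases lt_trichotomy (t : ℝ) (5 / 16) with h | h | h
  · filter_upwards [(isOpen_Iio.preimage hcoe).mem_nhds h] with t' ht'
    have e1 : (t' : ℝ) ≤ 5 / 16 := le_of_lt ht'
    simp [threePieces, e1, h.le]
  · have hlt : (t : ℝ) < 7 / 16 := by rw [h]; norm_num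
    have him : ∀ᶠ z in 𝓝 (standardLoop w ε t), z.im < 0 :=
      (isOpen_Iio.preimage Complex.continuous_im).mem_nhds (standardLoop_im_neg hε h)
    filter_upwards [(isOpen_Iio.preimage hcoe).mem_nhds hlt,
      (standardLoop w ε).continuous.continuousAt.eventually him.eventually_nhds] with t' ht' hz
    have e1 : (t' : ℝ) ≤ 7 / 16 := le_of_lt ht'
    simp only [threePieces, h.le, e1, if_true]
    split_ifs with h4
    · rfl
    · filter_upwards [hz] with z hz
      exact (h12 z hz).symm
  · rcases lt_trichotomy (t : ℝ) (7 / 16) with h' | h' | h'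
    · filter_upwards [(isOpen_Iio.preimage hcoe).mem_nhds h',
        (isOpen_Ioi.preimage hcoe).mem_nhds h] with t' ht' ht''
      have e1 : (t' : ℝ) ≤ 7 / 16 := le_of_lt ht'
      have e2 : ¬ (t' : ℝ) ≤ 5 / 16 := not_le.2 ht''
      simp [threePieces, e1, e2, h.not_ge, h'.le]
    · have him : ∀ᶠ z in 𝓝 (standardLoop w ε t), 0 < z.im :=
        (isOpen_Ioi.preimage Complex.continuous_im).mem_nhds (standardLoop_im_pos hε h')
      filter_upwards [(isOpen_Ioi.preimage hcoe).mem_nhds h,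
        (standardLoop w ε).continuous.continuousAt.eventually him.eventually_nhds] with t' ht' hz
      have e2 : ¬ (t' : ℝ) ≤ 5 / 16 := not_le.2 ht'
      simp only [threePieces, e2, h.not_ge, h'.le, if_true, if_false]
      split_ifs with h4
      · rfl
      · filter_upwards [hz] with z hz
        exact (h23 z hz).symm
    · filter_upwards [(isOpen_Ioi.preimage hcoe).mem_nhds h'] with t' ht'
      have e1 : ¬ (t' : ℝ) ≤ 7 / 16 := not_le.2 ht'
      have e2 : ¬ (t' : ℝ) ≤ 5 / 16 := fun h => e1 (h.trans (by norm_num))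
      simp [threePieces, e1, e2, h.not_ge, h'.not_ge]

/-! ### Branches of logarithms and the continuation of `log (1 - z)`. -/

/-- On a disc, a holomorphic function without zeros has a logarithm, with a prescribed value at one
point. -/
theorem exists_exp_eq_of_differentiableOn {f : ℂ → ℂ} {c : ℂ} {r : ℝ}
    (hf : DifferentiableOn ℂ f (Metric.ball c r)) (h0 : ∀ z ∈ Metric.ball c r, f z ≠ 0) {b v : ℂ}
    (hb : b ∈ Metric.ball c r) (hv : Complex.exp v = f b) :
    ∃ L : ℂ → ℂ, DifferentiableOn ℂ L (Metric.ball c r) ∧ L b = v ∧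
      ∀ z ∈ Metric.ball c r, Complex.exp (L z) = f z := by
  have hd : DifferentiableOn ℂ (fun z => deriv f z / f z) (Metric.ball c r) :=
    (hf.deriv Metric.isOpen_ball).div hf h0
  obtain ⟨L, hLb, hL⟩ := hd.isExactOn_ball.with_val_at b v
  refine ⟨L, fun z hz => (hL z hz).differentiableAt.differentiableWithinAt, hLb, fun z hz => ?_⟩
  have hf' : ∀ z ∈ Metric.ball c r, HasDerivAt f (deriv f z) z := fun z hz =>
    (hf.differentiableAt (Metric.isOpen_ball.mem_nhds hz)).hasDerivAt
  -- `L` is a primitive of `f'/f`, so `e^{-L} f` is constant, with value `1` at `b`.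
  have hq : ∀ z ∈ Metric.ball c r, HasDerivAt (fun z => Complex.exp (-L z) * f z) 0 z := by
    intro z hz
    convert! ((hL z hz).neg.cexp).mul (hf' z hz) using 1
    have := h0 z hz
    field_simp
    simp
  have hconst := Metric.isOpen_ball.is_const_of_deriv_eq_zero
    (convex_ball c r).isPreconnected
    (fun z hz => (hq z hz).differentiableAt.differentiableWithinAt)
    (fun z hz => (hq z hz).deriv) hz hb
  simp only [hLb, ← hv, ← Complex.exp_add, neg_add_cancel, Complex.exp_zero] at hconst
  rw [Complex.exp_neg, inv_mul_eq_one₀ (Complex.exp_ne_zero _)] at hconst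
  exact hconst

/-- Two germs of logarithms of the same function with the same value agree. -/
theorem eventuallyEq_of_exp_eventuallyEq {L M : ℂ → ℂ} {b : ℂ} (hL : ContinuousAt L b)
    (hM : ContinuousAt M b) (h : ∀ᶠ z in 𝓝 b, Complex.exp (L z) = Complex.exp (M z))
    (hb : L b = M b) : L =ᶠ[𝓝 b] M := by
  have hc : ContinuousAt (fun z => (L z - M z).im) b :=
    Complex.continuous_im.continuousAt.comp (hL.sub hM)
  -- The difference of the two logarithms is near `0`, inside the strip where `log (exp u) = u`.
  have hs : ∀ᶠ z in 𝓝 b, (L z - M z).im ∈ Set.Ioo (-Real.pi) Real.pi :=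
    hc (isOpen_Ioo.mem_nhds (by simp [hb, Real.pi_pos]))
  filter_upwards [h, hs] with z h1 h2
  have h3 : Complex.exp (L z - M z) = 1 := by
    rw [Complex.exp_sub, h1, div_self (Complex.exp_ne_zero _)]
  have h4 := Complex.log_exp h2.1 h2.2.le
  rw [h3, Complex.log_one] at h4
  exact sub_eq_zero.1 h4.symm

/-- The class of germs of logarithms of `1 - z`. -/
def IsLogOneSub (b : ℂ) (f : ℂ → ℂ) : Prop :=
  AnalyticAt ℂ f b ∧ ∀ᶠ z in 𝓝 b, Complex.exp (f z) = 1 - z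

theorem extendsLocally_isLogOneSub : ExtendsLocally IsLogOneSub {1}ᶜ := by
  intro a ha
  obtain ⟨r, hr, hball⟩ := Metric.isOpen_iff.1 (isOpen_compl_singleton (x := (1 : ℂ))) a ha
  refine ⟨r, hr, fun b hb f hf => ?_⟩
  have hne : ∀ z ∈ Metric.ball a r, (1 : ℂ) - z ≠ 0 := fun z hz =>
    sub_ne_zero.2 (Ne.symm (hball hz))
  obtain ⟨L, hL, hLb, hexp⟩ := exists_exp_eq_of_differentiableOn (f := fun z => 1 - z)
    (by fun_prop) hne hb hf.2.self_of_nhds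
  have han := hL.analyticOnNhd Metric.isOpen_ball
  have hev : ∀ c ∈ Metric.ball a r, ∀ᶠ z in 𝓝 c, Complex.exp (L z) = 1 - z := fun c hc =>
    Filter.eventually_of_mem (Metric.isOpen_ball.mem_nhds hc) hexp
  refine ⟨L, hL, ?_, fun c hc => ⟨han c hc, hev c hc⟩⟩
  refine eventuallyEq_of_exp_eventuallyEq (han b hb).continuousAt hf.1.continuousAt ?_ hLb
  filter_upwards [hev b hb, hf.2] with z h1 h2
  rw [h1, h2]

theorem Complex.log_neg_of_im_pos {z : ℂ} (hz : 0 < z.im) :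
    Complex.log (-z) = Complex.log z - Real.pi * Complex.I := by
  rw [Complex.log, Complex.log, norm_neg, Complex.arg_neg_eq_arg_sub_pi_of_im_pos hz]
  push_cast
  ring

theorem Complex.log_neg_of_im_neg {z : ℂ} (hz : z.im < 0) :
    Complex.log (-z) = Complex.log z + Real.pi * Complex.I := by
  rw [Complex.log, Complex.log, norm_neg, Complex.arg_neg_eq_arg_add_pi_of_im_neg hz]
  push_cast
  ring

/-- The continuation of `log (1 - z)` along a loop about `1` ends in `log (1 - z) + 2πi`. -/
theorem IsLoopAboutOne.exists_continuation_log {w : ℂ} (hw : ‖w‖ < 1)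
    (hw' : w ∈ Complex.slitPlane) {γ : Path w w} (hloop : IsLoopAboutOne γ) :
    ∃ g, IsAnalyticContinuationAlong γ g ∧
      (∀ t, ∀ᶠ z in 𝓝 (γ t), Complex.exp (g t z) = 1 - z) ∧
      g 1 w - g 0 w = 2 * Real.pi * Complex.I := by
  obtain ⟨ε, hε, H, hH⟩ := hloop
  set F₁ : ℂ → ℂ := fun z => Complex.log (1 - z)
  set F₂ : ℂ → ℂ := fun z => Complex.log (z - 1) + Real.pi * Complex.I
  set F₃ : ℂ → ℂ := fun z => Complex.log (1 - z) + 2 * Real.pi * Complex.I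
  have h1 : ∀ z ∈ cutRight ∩ Complex.slitPlane, IsLogOneSub z F₁ := fun z hz => by
    refine ⟨(analyticAt_const.sub analyticAt_id).clog hz.1, ?_⟩
    filter_upwards [isOpen_cutRight.mem_nhds hz.1] with y hy
    exact Complex.exp_log (Complex.slitPlane_ne_zero hy)
  have h2 : ∀ z ∈ cutLeft, IsLogOneSub z F₂ := fun z hz => by
    refine ⟨((analyticAt_id.sub analyticAt_const).clog hz).add analyticAt_const, ?_⟩
    filter_upwards [isOpen_cutLeft.mem_nhds hz] with y hy
    rw [Complex.exp_add, Complex.exp_log (Complex.slitPlane_ne_zero hy), Complex.exp_pi_mul_I]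
    ring
  have h3 : ∀ z ∈ cutRight ∩ Complex.slitPlane, IsLogOneSub z F₃ := fun z hz => by
    refine ⟨(h1 z hz).1.add analyticAt_const, ?_⟩
    filter_upwards [(h1 z hz).2] with y hy
    rw [Complex.exp_add, hy, Complex.exp_two_pi_mul_I, mul_one]
  have h12 : ∀ z : ℂ, z.im < 0 → F₁ z = F₂ z := fun z hz => by
    have := Complex.log_neg_of_im_neg (z := z - 1) (by simpa using hz)
    rw [neg_sub] at this
    exact this
  have h23 : ∀ z : ℂ, 0 < z.im → F₂ z = F₃ z := fun z hz => by
    have := Complex.log_neg_of_im_pos (z := z - 1) (by simpa using hz)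
    rw [neg_sub] at this
    simp only [F₂, F₃, this]
    ring
  obtain ⟨g, hg, hgP, h0, h1'⟩ := extendsLocally_isLogOneSub.exists_continuation_of_homotopy H
    (fun p => (hH p).2)
    (isAnalyticContinuationAlong_threePieces hw hw' hε (fun z hz => (h1 z hz).1)
      (fun z hz => (h2 z hz).1) (fun z hz => (h3 z hz).1) h12 h23)
    (threePieces_induction hw hw' hε h1 h2 h3)
  refine ⟨g, hg, fun t => (hgP t).2, ?_⟩
  rw [h1'.self_of_nhds, h0.self_of_nhds, threePieces_zero, threePieces_one]
  simp [F₁, F₃]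

/-! ### The integral of `dx/(1-x)` around the loop. -/

theorem curveIntegralFun_formOne {a b : ℂ} (γ : Path a b) (t : ℝ) :
    curveIntegralFun formOne γ t =
      (1 - γ.extend t)⁻¹ * derivWithin γ.extend (Set.Icc 0 1) t := by
  simp [curveIntegralFun_def, formOne]

theorem IsPiecewiseC1.curveIntegrable {a b : ℂ} {γ : Path a b} (hγ : IsPiecewiseC1 γ)
    {ω : ℂ → ℂ →L[ℂ] ℂ} {S : Set ℂ} (hω : ContinuousOn ω S) (hS : ∀ t, γ t ∈ S) :
    CurveIntegrable ω γ := by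
  obtain ⟨n, τ, hτ, h0, h1, hC⟩ := hγ
  have key : ∀ k ≤ n, IntervalIntegrable (curveIntegralFun ω γ) MeasureTheory.volume
      (τ 0) (τ k) := by
    intro k hk
    refine IntervalIntegrable.trans_iterate fun i hi => ?_
    have hle := hτ (Nat.lt_succ_self i)
    have hsub : Set.Icc (τ i) (τ (i + 1)) ⊆ Set.Icc 0 1 := by
      rw [← h0, ← h1]
      exact Set.Icc_subset_Icc (hτ.monotone (Nat.zero_le _)) (hτ.monotone (by omega))
    have hcont : ContinuousOn (fun t => ω (γ.extend t)
        (derivWithin γ.extend (Set.Icc (τ i) (τ (i + 1))) t)) (Set.Icc (τ i) (τ (i + 1))) := by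
      apply ContinuousOn.clm_apply
      · exact hω.comp γ.continuous_extend.continuousOn fun t ht => by
          rw [Path.extend_apply γ (hsub ht)]; exact hS _
      · exact (hC i (by omega)).continuousOn_derivWithin (uniqueDiffOn_Icc hle) le_rfl
    -- The one-sided derivatives relative to the piece and to `[0,1]` may differ at the breakpoints,
    -- which form a null set.
    refine (hcont.intervalIntegrable_of_Icc hle.le).congr_ae ?_
    rw [Set.uIoc_of_le hle.le, ← MeasureTheory.restrict_Ioo_eq_restrict_Ioc]
    filter_upwards [MeasureTheory.ae_restrict_mem measurableSet_Ioo] with t ht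
    have hn1 : Set.Icc (τ i) (τ (i + 1)) ∈ 𝓝 t := Icc_mem_nhds ht.1 ht.2
    rw [curveIntegralFun_def, derivWithin_of_mem_nhds hn1,
      derivWithin_of_mem_nhds (Filter.mem_of_superset hn1 hsub)]
  have := key n le_rfl
  rwa [h0, h1] at this

theorem IsPiecewiseC1.exists_countable_hasDerivAt {a b : ℂ} {γ : Path a b}
    (hγ : IsPiecewiseC1 γ) : ∃ S : Set ℝ, S.Countable ∧ ∀ t ∈ Set.Ioo (0 : ℝ) 1 \ S,
      HasDerivAt γ.extend (derivWithin γ.extend (Set.Icc 0 1) t) t := by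
  obtain ⟨n, τ, hτ, h0, h1, hC⟩ := hγ
  refine ⟨Set.range τ, Set.countable_range τ, fun t ht => ?_⟩
  have hex : ∃ k, t ≤ τ k := ⟨n, by rw [h1]; exact ht.1.2.le⟩
  classical
  -- `τ (i + 1)` is the first breakpoint not before `t`; it is not `τ 0 = 0`, since `t > 0`.
  obtain ⟨i, hi⟩ : ∃ i, Nat.find hex = i + 1 := by
    refine Nat.exists_eq_succ_of_ne_zero fun h => ?_
    have := Nat.find_spec hex
    rw [h, h0] at this
    exact ht.1.1.not_ge this
  have hlt : t < τ (i + 1) := lt_of_le_of_ne (hi ▸ Nat.find_spec hex) fun h => ht.2 ⟨_, h.symm⟩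
  have hgt : τ i < t := not_le.1 (Nat.find_min hex (by omega))
  have hin : i < n := by
    have : Nat.find hex ≤ n := Nat.find_min' hex (by rw [h1]; exact ht.1.2.le)
    omega
  have hd := (((hC i hin).differentiableOn one_ne_zero) t ⟨hgt.le, hlt.le⟩).differentiableAt
    (Icc_mem_nhds hgt hlt)
  rw [derivWithin_of_mem_nhds (Icc_mem_nhds ht.1.1 ht.1.2)]
  exact hd.hasDerivAt

/-- Minus the continued logarithm, evaluated along the path, is a primitive of the pulled back form:
near each time the germ can be frozen, and differentiating `exp G = 1 - z` gives `G' = -1/(1 - z)`.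
The breakpoints are a countable exceptional set. -/
theorem curveIntegral_formOne_eq_of_continuation {a b : ℂ} {γ : Path a b} (hγ : IsPiecewiseC1 γ)
    (hint : CurveIntegrable formOne γ) (h1 : ∀ t, γ t ≠ 1) {g : I → ℂ → ℂ}
    (hg : IsAnalyticContinuationAlong γ g)
    (hexp : ∀ t, ∀ᶠ z in 𝓝 (γ t), Complex.exp (g t z) = 1 - z) :
    curveIntegral formOne γ = g 0 a - g 1 b := by
  obtain ⟨S, hS, hd⟩ := hγ.exists_countable_hasDerivAt
  set ℓ : ℝ → ℂ := fun t => -g (Set.projIcc 0 1 zero_le_one t) (γ.extend t) with hℓ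
  have hloc : ∀ t : ℝ, ℓ =ᶠ[𝓝 t] fun u => -g (Set.projIcc 0 1 zero_le_one t) (γ.extend u) := by
    intro t
    filter_upwards [continuous_projIcc.continuousAt.eventually
      (hg.2 (Set.projIcc 0 1 zero_le_one t))] with u hu
    simp only [hℓ]
    exact congrArg Neg.neg hu.self_of_nhds
  have hext : ∀ t : ℝ, γ.extend t = γ (Set.projIcc 0 1 zero_le_one t) := fun t => rfl
  have hcont : Continuous ℓ := continuous_iff_continuousAt.2 fun t => by
    refine ContinuousAt.congr ?_ (hloc t).symm
    refine ContinuousAt.neg ?_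
    have := (hg.1 (Set.projIcc 0 1 zero_le_one t)).continuousAt
    rw [← hext] at this
    exact ContinuousAt.comp this γ.continuous_extend.continuousAt
  have hder : ∀ t ∈ Set.Ioo (0 : ℝ) 1 \ S, HasDerivAt ℓ (curveIntegralFun formOne γ t) t := by
    intro t ht
    refine HasDerivAt.congr_of_eventuallyEq ?_ (hloc t)
    set G := g (Set.projIcc 0 1 zero_le_one t)
    have hG : HasDerivAt G (deriv G (γ.extend t)) (γ.extend t) := by
      rw [hext]; exact (hg.1 _).differentiableAt.hasDerivAt
    have he : ∀ᶠ z in 𝓝 (γ.extend t), Complex.exp (G z) = 1 - z := by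
      rw [hext]; exact hexp _
    have hu : Complex.exp (G (γ.extend t)) * deriv G (γ.extend t) = -1 := by
      have e1 := hG.cexp.congr_of_eventuallyEq (Filter.EventuallyEq.symm he)
      exact e1.unique ((hasDerivAt_id _).const_sub 1)
    have hne : 1 - γ.extend t ≠ 0 := sub_ne_zero.2 (Ne.symm (h1 _))
    have hG' : deriv G (γ.extend t) = -(1 - γ.extend t)⁻¹ := by
      rw [he.self_of_nhds] at hu
      field_simp
      linear_combination hu
    convert! (hG.scomp t (hd t ht)).neg using 1
    rw [curveIntegralFun_formOne, hG', smul_eq_mul]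
    ring
  rw [curveIntegral_def, MeasureTheory.integral_eq_of_hasDerivAt_off_countable_of_le ℓ _
    zero_le_one hS hcont.continuousOn hder hint]
  simp [hℓ]
  ring

theorem IsLoopAboutOne.ne_one {w : ℂ} {γ : Path w w} (hloop : IsLoopAboutOne γ) (t : I) :
    γ t ≠ 1 := by
  obtain ⟨ε, hε, H, hH⟩ := hloop
  have := (hH (0, t)).2
  simpa using this

theorem IsLoopAboutOne.curveIntegrable_formOne {w : ℂ} {γ : Path w w} (hγ : IsPiecewiseC1 γ)
    (hloop : IsLoopAboutOne γ) : CurveIntegrable formOne γ := by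
  refine hγ.curveIntegrable (S := {1}ᶜ) ?_ hloop.ne_one
  have h : ContinuousOn (fun x : ℂ => 1 - x) {1}ᶜ := by fun_prop
  refine (h.inv₀ fun x hx => ?_).smul continuousOn_const
  exact sub_ne_zero.2 (Ne.symm hx)

theorem IsLoopAboutOne.curveIntegral_formOne {w : ℂ} (hw : ‖w‖ < 1)
    (hw' : w ∈ Complex.slitPlane) {γ : Path w w} (hγ : IsPiecewiseC1 γ)
    (hloop : IsLoopAboutOne γ) : curveIntegral formOne γ = -(2 * Real.pi * Complex.I) := by
  obtain ⟨g, hg, hexp, hval⟩ := hloop.exists_continuation_log hw hw'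
  rw [curveIntegral_formOne_eq_of_continuation hγ (hloop.curveIntegrable_formOne hγ)
    hloop.ne_one hg hexp, ← hval, neg_sub]

/-! ### Holomorphic dependence of integrals on a parameter. -/

/-- A dominated integral of holomorphic functions is holomorphic in the parameter. -/
theorem differentiableAt_integral_of_dominated_ball {α : Type*} [MeasurableSpace α]
    {μ : Measure α} {F : ℂ → α → ℂ} {M : α → ℝ} {c : ℂ} {r : ℝ} (hr : 0 < r)
    (hmeas : ∀ z, AEStronglyMeasurable (F z) μ) (hM : Integrable M μ)
    (hbound : ∀ᵐ t ∂μ, ∀ z ∈ Metric.ball c r, ‖F z t‖ ≤ M t)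
    (hdiff : ∀ᵐ t ∂μ, DifferentiableOn ℂ (fun z => F z t) (Metric.ball c r)) :
    DifferentiableAt ℂ (fun z => ∫ t, F z t ∂μ) c := by
  have hder : ∀ᵐ t ∂μ, ∀ z ∈ Metric.ball c (r / 2),
      HasDerivAt (fun z => F z t) (deriv (fun z => F z t) z) z := by
    filter_upwards [hdiff] with t ht z hz
    exact (ht.differentiableAt (Metric.isOpen_ball.mem_nhds
      (Metric.ball_subset_ball (by linarith) hz))).hasDerivAt
  -- Cauchy's estimate on circles of radius `r / 4` about points of the half-size disc bounds the
  -- derivative, so no separate domination of it is needed.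
  refine (hasDerivAt_integral_of_dominated_loc_of_deriv_le (F := F)
    (F' := fun z t => deriv (fun z => F z t) z) (bound := fun t => M t / (r / 4))
    (Metric.ball_mem_nhds c (half_pos hr)) (.of_forall hmeas) ?_ ?_ ?_ (hM.div_const _)
    hder).2.differentiableAt
  · refine hM.mono' (hmeas c) ?_
    filter_upwards [hbound] with t ht
    exact ht c (Metric.mem_ball_self hr)
  -- The derivative is measurable in `t` as a limit of difference quotients.
  · refine aestronglyMeasurable_of_tendsto_ae (𝓝[≠] c)
      (f := fun z t => slope (fun z => F z t) c z) (fun z => ?_) ?_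
    · simp only [slope_def_field, div_eq_inv_mul]
      exact aestronglyMeasurable_const.mul ((hmeas z).sub (hmeas c))
    · filter_upwards [hder] with t ht
      exact (hasDerivAt_iff_tendsto_slope.1 (ht c (Metric.mem_ball_self (half_pos hr))))
  · filter_upwards [hbound, hdiff] with t h1 h2 z hz
    have hsub : Metric.closedBall z (r / 4) ⊆ Metric.ball c r := by
      intro y hy
      have := dist_triangle y z c
      simp only [Metric.mem_ball, Metric.mem_closedBall] at *
      linarith
    refine Complex.norm_deriv_le_of_forall_mem_sphere_norm_le (by linarith)
      ⟨h2.mono (Metric.ball_subset_closedBall.trans hsub), ?_⟩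
      fun y hy => h1 y (hsub (Metric.sphere_subset_closedBall hy))
    exact (h2.continuousOn.mono ((closure_mono Metric.ball_subset_closedBall).trans
      (Metric.isClosed_closedBall.closure_subset.trans hsub)))

theorem dslope_of_ne' (f : ℂ → ℂ) {a b : ℂ} (h : b ≠ a) :
    dslope f a b = (f b - f a) / (b - a) := by
  rw [dslope_of_ne _ h, slope_def_field]

/-- The integral of the difference quotients of a holomorphic function over `(0, 1)` is
holomorphic. -/
theorem differentiableOn_integral_dslope {ψ : ℂ → ℂ} {U : Set ℂ} (hU : IsOpen U)
    (hψ : DifferentiableOn ℂ ψ U) (h01 : ∀ t ∈ Set.Ioo (0 : ℝ) 1, (t : ℂ) ∈ U)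
    (hint : IntegrableOn (fun t : ℝ => ψ t) (Set.Ioo 0 1)) :
    DifferentiableOn ℂ (fun ζ => ∫ t in Set.Ioo (0 : ℝ) 1, dslope ψ t ζ) U := by
  intro ζ₀ hζ₀
  obtain ⟨ε, hε, hball⟩ := Metric.isOpen_iff.1 hU ζ₀ hζ₀
  set r := ε / 4 with hr
  have hr0 : 0 < r := by positivity
  have hsub : Metric.closedBall ζ₀ (2 * r) ⊆ U := fun y hy => hball (by
    simp only [Metric.mem_ball, Metric.mem_closedBall] at *
    linarith)
  obtain ⟨C, hC⟩ := (isCompact_closedBall ζ₀ (2 * r)).exists_bound_of_continuousOn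
    (hψ.continuousOn.mono hsub)
  obtain ⟨C', hC'⟩ := (isCompact_closedBall ζ₀ (2 * r)).exists_bound_of_continuousOn
    ((hψ.deriv hU).continuousOn.mono hsub)
  have hC0 : 0 ≤ C := (norm_nonneg _).trans (hC ζ₀ (Metric.mem_closedBall_self (by positivity)))
  have hC'0 : 0 ≤ C' :=
    (norm_nonneg _).trans (hC' ζ₀ (Metric.mem_closedBall_self (by positivity)))
  refine (differentiableAt_integral_of_dominated_ball (M := fun t : ℝ => (C + ‖ψ t‖) / r + C')
    hr0 (fun ζ => ?_) ?_ ?_ ?_).differentiableWithinAt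
  · have hm : AEStronglyMeasurable (fun t : ℝ => (ψ ζ - ψ t) / (ζ - t))
        (volume.restrict (Set.Ioo 0 1)) := by
      have h2 : Measurable (fun t : ℝ => (ζ - t)⁻¹) := by fun_prop
      simp only [div_eq_mul_inv]
      exact (aestronglyMeasurable_const.sub hint.1).mul h2.aestronglyMeasurable
    refine hm.congr ?_
    have hne : ∀ᵐ t : ℝ, t ≠ ζ.re := by simp [ae_iff, measure_singleton]
    filter_upwards [ae_restrict_of_ae hne] with t ht
    rw [dslope_of_ne']
    intro h
    exact ht (by rw [h, Complex.ofReal_re])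
  · have : IsFiniteMeasure (volume.restrict (Set.Ioo (0 : ℝ) 1)) := ⟨by simp⟩
    exact (((integrable_const C).add hint.norm).div_const r).add (integrable_const C')
  · filter_upwards with t ζ hζ
    have hζ2 : ζ ∈ Metric.ball ζ₀ (2 * r) := Metric.ball_subset_ball (by linarith) hζ
    -- For `t` close to `ζ₀` the difference quotient is bounded by `sup |ψ'|`; for the other `t` its
    -- denominator is at least `r`.
    by_cases ht : (t : ℂ) ∈ Metric.ball ζ₀ (2 * r)
    · refine le_add_of_nonneg_of_le (by positivity) ?_
      by_cases hne : ζ = t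
      · rw [hne, dslope_same]
        exact hC' _ (Metric.ball_subset_closedBall ht)
      · rw [dslope_of_ne' _ hne, norm_div, div_le_iff₀ (norm_pos_iff.2 (sub_ne_zero.2 hne))]
        exact (convex_ball ζ₀ (2 * r)).norm_image_sub_le_of_norm_deriv_le
          (fun x hx => hψ.differentiableAt (hU.mem_nhds (hsub (Metric.ball_subset_closedBall hx))))
          (fun x hx => hC' x (Metric.ball_subset_closedBall hx)) ht hζ2
    · refine le_add_of_le_of_nonneg ?_ hC'0
      have hd : r ≤ ‖ζ - t‖ := by
        have := dist_triangle (t : ℂ) ζ ζ₀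
        simp only [Metric.mem_ball, not_lt] at ht hζ
        rw [← dist_eq_norm, dist_comm]
        linarith
      have hne : ζ ≠ t := fun h => by
        rw [h, sub_self, norm_zero] at hd
        exact hr0.not_ge hd
      rw [dslope_of_ne' _ hne, norm_div]
      gcongr
      exact (norm_sub_le _ _).trans
        (by gcongr; exact hC _ (Metric.ball_subset_closedBall hζ2))
  · filter_upwards [ae_restrict_mem measurableSet_Ioo] with t ht
    exact ((Complex.differentiableOn_dslope (hU.mem_nhds (h01 t ht))).2 hψ).mono
      fun y hy => hsub (Metric.ball_subset_closedBall
        (Metric.ball_subset_ball (by linarith) hy))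

theorem one_sub_mul_ne_zero_of_mem_cutRight {z₀ : ℂ} (hz₀ : z₀ ∈ cutRight) {t : ℝ}
    (ht : t ∈ Set.Icc (0 : ℝ) 1) : (1 - t * z₀ : ℂ) ≠ 0 := by
  intro h
  have e1 := congrArg Complex.re h
  have e2 := congrArg Complex.im h
  simp only [Complex.sub_re, Complex.sub_im, Complex.one_re, Complex.one_im, Complex.re_ofReal_mul,
    Complex.im_ofReal_mul, Complex.zero_re, Complex.zero_im] at e1 e2
  rcases mem_cutRight.1 hz₀ with h3 | h3
  · rcases ht.2.eq_or_lt with h4 | h4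
    · rw [h4] at e1
      linarith
    · nlinarith [mul_nonneg ht.1 (sub_nonneg.2 h3.le)]
  · have : t = 0 := by simpa [h3] using e2
    rw [this] at e1
    norm_num at e1

theorem integrableOn_mul_div {ψ : ℝ → ℂ} (hint : IntegrableOn ψ (Set.Ioo 0 1)) {z : ℂ}
    (hz : z ∈ cutRight) : IntegrableOn (fun t : ℝ => ψ t * (z / (1 - t * z))) (Set.Ioo 0 1) := by
  rw [← integrableOn_Icc_iff_integrableOn_Ioo] at hint ⊢
  refine hint.mul_continuousOn (continuousOn_const.div (by fun_prop) fun t ht => ?_) isCompact_Icc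
  exact one_sub_mul_ne_zero_of_mem_cutRight hz ht

/-- The integral of `ψ t * z / (1 - t z)` over `(0, 1)` is holomorphic outside `[1, ∞)`. -/
theorem differentiableOn_integral_mul_div {ψ : ℝ → ℂ} (hint : IntegrableOn ψ (Set.Ioo 0 1)) :
    DifferentiableOn ℂ (fun z => ∫ t in Set.Ioo (0 : ℝ) 1, ψ t * (z / (1 - t * z))) cutRight := by
  intro z₀ hz₀
  have hne := fun t ht => one_sub_mul_ne_zero_of_mem_cutRight hz₀ (t := t) ht
  -- The minimum `δ` of `|1 - t z₀|` on `[0,1]` is positive, and moving `z` by less than `δ / 2`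
  -- keeps the denominator at least `δ / 2`.
  obtain ⟨t₀, ht₀, hmin⟩ := isCompact_Icc.exists_isMinOn (Set.nonempty_Icc.2 zero_le_one)
    (f := fun t : ℝ => ‖1 - t * z₀‖) (by fun_prop)
  set δ := ‖(1 - t₀ * z₀ : ℂ)‖ with hδ
  have hδ0 : 0 < δ := norm_pos_iff.2 (hne t₀ ht₀)
  have hlow : ∀ t ∈ Set.Ioo (0 : ℝ) 1, ∀ z ∈ Metric.ball z₀ (δ / 2), δ / 2 ≤ ‖1 - t * z‖ := by
    intro t ht z hz
    have h1 : δ ≤ ‖1 - t * z₀‖ := hmin ⟨ht.1.le, ht.2.le⟩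
    have h2 : ‖(1 - t * z₀ : ℂ)‖ ≤ ‖1 - t * z‖ + ‖t * (z - z₀)‖ := by
      refine le_trans (le_of_eq ?_) (norm_add_le _ _)
      congr 1; ring
    have h3 : ‖(t : ℂ) * (z - z₀)‖ ≤ ‖z - z₀‖ := by
      rw [norm_mul, Complex.norm_real, Real.norm_of_nonneg ht.1.le]
      exact mul_le_of_le_one_left (norm_nonneg _) ht.2.le
    rw [Metric.mem_ball, dist_eq_norm] at hz
    linarith
  refine (differentiableAt_integral_of_dominated_ball
    (M := fun t => ‖ψ t‖ * ((‖z₀‖ + δ / 2) / (δ / 2)))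
    (half_pos hδ0) (fun z => ?_) (hint.norm.mul_const _) ?_ ?_).differentiableWithinAt
  · have h2 : Measurable (fun t : ℝ => z / (1 - t * z)) := by fun_prop
    exact hint.1.mul h2.aestronglyMeasurable
  · filter_upwards [ae_restrict_mem measurableSet_Ioo] with t ht z hz
    have h1 := hlow t ht z hz
    have h2 : ‖z‖ ≤ ‖z₀‖ + δ / 2 := by
      have := norm_add_le z₀ (z - z₀)
      rw [Metric.mem_ball, dist_eq_norm] at hz
      rw [add_sub_cancel] at this
      linarith
    rw [norm_mul, norm_div]
    gcongr
  · filter_upwards [ae_restrict_mem measurableSet_Ioo] with t ht z hz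
    have h1 : (1 - t * z : ℂ) ≠ 0 := norm_pos_iff.1 ((half_pos hδ0).trans_le (hlow t ht z hz))
    have : DifferentiableAt ℂ (fun z : ℂ => ψ t * (z / (1 - t * z))) z := by
      fun_prop (disch := exact h1)
    exact this.differentiableWithinAt

/-! ### The integral representation, its two sheets and the jump between them. -/

/-- The density `(-log ζ) ^ (s - 1)`. -/
noncomputable def negLogPow (s ζ : ℂ) : ℂ := Complex.exp ((s - 1) * Complex.log (-Complex.log ζ))

/-- The polylogarithm on the complement of `[1, ∞)`. -/
noncomputable def polylogRight (s z : ℂ) : ℂ :=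
  1 / Complex.Gamma s * ∫ t in Set.Ioo (0 : ℝ) 1, negLogPow s t * (z / (1 - t * z))

/-- The continuation of the polylogarithm from the upper half plane to the complement of
`(-∞, 1]`. -/
noncomputable def polylogLeft (s z : ℂ) : ℂ :=
  1 / Complex.Gamma s * (-(∫ t in Set.Ioo (0 : ℝ) 1, dslope (negLogPow s) t z⁻¹) +
    negLogPow s z⁻¹ * (Complex.log z⁻¹ - Complex.log (1 - z⁻¹) + Real.pi * Complex.I))

/-- `-log z` is a real number `≤ 0` only for `z ≥ 1`. This is why `log (-log z) + πi` is a
holomorphic branch of `log log z` on the whole region. -/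
theorem neg_log_mem_slitPlane {z : ℂ} (hz : z ∈ cutRight ∩ Complex.slitPlane) :
    -Complex.log z ∈ Complex.slitPlane := by
  rw [Complex.mem_slitPlane_iff]
  by_contra! h
  simp only [Complex.neg_re, Complex.neg_im, neg_eq_zero] at h
  have h1 : Complex.log z = ((Complex.log z).re : ℂ) := Complex.ext (by simp) (by simp [h.2])
  have h2 : z = (Real.exp (Complex.log z).re : ℝ) := by
    rw [Complex.ofReal_exp, ← h1, Complex.exp_log (Complex.slitPlane_ne_zero hz.2)]
  have h3 := hz.1
  rw [h2, mem_cutRight, Complex.ofReal_re, Complex.ofReal_im] at h3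
  have := Real.one_le_exp (x := (Complex.log z).re) (by linarith)
  rcases h3 with h3 | h3
  · linarith
  · exact h3 rfl

theorem analyticAt_log_neg_log {z : ℂ} (hz : z ∈ cutRight ∩ Complex.slitPlane) :
    AnalyticAt ℂ (fun z => Complex.log (-Complex.log z)) z :=
  ((analyticAt_id.clog hz.2).neg).clog (neg_log_mem_slitPlane hz)

theorem analyticAt_negLogPow {s z : ℂ} (hz : z ∈ cutRight ∩ Complex.slitPlane) :
    AnalyticAt ℂ (negLogPow s) z :=
  (analyticAt_const.mul (analyticAt_log_neg_log hz)).cexp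

theorem inv_mem_of_mem_cutLeft {z : ℂ} (hz : z ∈ cutLeft) :
    z⁻¹ ∈ cutRight ∩ Complex.slitPlane := by
  have h0 : z ≠ 0 := by
    rintro rfl
    simp [mem_cutLeft] at hz
    linarith
  have hn : 0 < Complex.normSq z := Complex.normSq_pos.2 h0
  rw [Set.mem_inter_iff, mem_cutRight, Complex.mem_slitPlane_iff, Complex.inv_re, Complex.inv_im]
  rcases mem_cutLeft.1 hz with h | h
  · refine ⟨.inl ?_, .inl (div_pos (by linarith) hn)⟩
    rw [div_lt_one hn, Complex.normSq_apply]
    nlinarith [mul_self_nonneg z.im]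
  · have : -z.im / Complex.normSq z ≠ 0 := div_ne_zero (neg_ne_zero.2 h) hn.ne'
    exact ⟨.inr this, .inr this⟩

theorem ofReal_mem_of_mem_Ioo {t : ℝ} (ht : t ∈ Set.Ioo (0 : ℝ) 1) :
    (t : ℂ) ∈ cutRight ∩ Complex.slitPlane :=
  ⟨mem_cutRight.2 (.inl (by simpa using ht.2)), by simpa using ht.1⟩

theorem negLogPow_exp_neg {x : ℝ} (hx : 0 < x) (s : ℂ) :
    negLogPow s (Real.exp (-x) : ℝ) = (x : ℂ) ^ (s - 1) := by
  rw [negLogPow, ← Complex.ofReal_log (Real.exp_pos _).le, Real.log_exp, Complex.ofReal_neg,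
    neg_neg, Complex.cpow_def_of_ne_zero (by exact_mod_cast hx.ne'), mul_comm]

theorem image_exp_neg_Ioi : (fun x : ℝ => Real.exp (-x)) '' Set.Ioi 0 = Set.Ioo 0 1 := by
  ext t
  constructor
  · rintro ⟨x, hx, rfl⟩
    exact ⟨Real.exp_pos _, Real.exp_lt_one_iff.2 (neg_neg_of_pos hx)⟩
  · rintro ⟨h0, h1⟩
    exact ⟨-Real.log t, neg_pos.2 (Real.log_neg h0 h1), by simp [Real.exp_log h0]⟩

theorem hasDerivWithinAt_exp_neg (x : ℝ) : HasDerivWithinAt (fun x : ℝ => Real.exp (-x))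
    (-Real.exp (-x)) (Set.Ioi 0) x := by
  simpa using ((hasDerivAt_neg x).exp).hasDerivWithinAt

theorem injOn_exp_neg (S : Set ℝ) : Set.InjOn (fun x : ℝ => Real.exp (-x)) S := fun x _ y _ h => by
  simpa using h

theorem integrableOn_negLogPow {s : ℂ} (hs : 0 < s.re) :
    IntegrableOn (fun t : ℝ => negLogPow s t) (Set.Ioo 0 1) := by
  rw [← image_exp_neg_Ioi, integrableOn_image_iff_integrableOn_abs_deriv_smul measurableSet_Ioi
    (fun x _ => hasDerivWithinAt_exp_neg x) (injOn_exp_neg _)]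
  refine (Complex.GammaIntegral_convergent hs).congr_fun (fun x hx => ?_) measurableSet_Ioi
  simp only [negLogPow_exp_neg hx, abs_neg, abs_of_pos (Real.exp_pos _), Complex.real_smul]

/-- Under `t = e^{-x}` the integral is the Mellin transform of `∑ z^{n+1} e^{-(n+1)x}`, which is
integrated termwise; each term contributes `Γ(s) z^{n+1} / (n+1)^s`. -/
theorem polylogRight_eq_polylog {s z : ℂ} (hs : 0 < s.re) (hz : ‖z‖ < 1) :
    polylogRight s z = polylog s z := by
  have hG : Complex.Gamma s ≠ 0 := Complex.Gamma_ne_zero_of_re_pos hs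
  have hzt : ∀ x ∈ Set.Ioi (0 : ℝ), ‖z * Real.exp (-x)‖ < 1 := fun x hx => by
    rw [norm_mul, Complex.norm_real, Real.norm_of_nonneg (Real.exp_pos _).le]
    exact mul_lt_one_of_nonneg_of_lt_one_left (norm_nonneg _) hz
      (Real.exp_lt_one_iff.2 (neg_neg_of_pos hx)).le
  have hsum := hasSum_mellin (ι := ℕ) (a := fun n => z ^ (n + 1)) (p := fun n => (n : ℝ) + 1)
    (F := fun x => z * Real.exp (-x) / (1 - z * Real.exp (-x))) (s := s)
    (fun n => .inr (by positivity)) hs (fun x hx => ?_) ?_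
  · have hval : mellin (fun x => z * Real.exp (-x) / (1 - z * Real.exp (-x))) s =
        ∫ t in Set.Ioo (0 : ℝ) 1, negLogPow s t * (z / (1 - t * z)) := by
      rw [← image_exp_neg_Ioi, integral_image_eq_integral_abs_deriv_smul measurableSet_Ioi
        (fun x _ => hasDerivWithinAt_exp_neg x) (injOn_exp_neg _), mellin]
      refine setIntegral_congr_fun measurableSet_Ioi fun x hx => ?_
      simp only [negLogPow_exp_neg hx, abs_neg, abs_of_pos (Real.exp_pos _), Complex.real_smul,
        smul_eq_mul]
      ring
    rw [polylogRight, ← hval, ← hsum.tsum_eq, polylog, ← tsum_mul_left]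
    refine tsum_congr fun n => ?_
    push_cast
    field_simp
  · have := (hasSum_geometric_of_norm_lt_one (hzt x hx)).mul_left (z * Real.exp (-x))
    rw [div_eq_mul_inv]
    refine this.congr_fun fun n => ?_
    rw [mul_pow, ← Complex.ofReal_pow, ← Real.exp_nat_mul]
    have : Real.exp (-((n : ℝ) + 1) * x) = Real.exp (-x) * Real.exp (n * -x) := by
      rw [← Real.exp_add]; congr 1; ring
    rw [this]
    push_cast
    ring
  · refine Summable.of_nonneg_of_le (fun n => by positivity) (fun n => ?_)
      ((summable_geometric_of_lt_one (norm_nonneg z) hz).mul_left ‖z‖)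
    rw [norm_pow, ← pow_succ']
    exact div_le_self (by positivity) (Real.one_le_rpow (by linarith [n.cast_nonneg (α := ℝ)]) hs.le)

theorem analyticAt_polylogRight {s z : ℂ} (hs : 0 < s.re) (hz : z ∈ cutRight) :
    AnalyticAt ℂ (polylogRight s) z :=
  analyticAt_const.mul ((differentiableOn_integral_mul_div (integrableOn_negLogPow hs)).analyticAt
    (isOpen_cutRight.mem_nhds hz))

theorem analyticAt_polylogLeft {s z : ℂ} (hs : 0 < s.re) (hz : z ∈ cutLeft) :
    AnalyticAt ℂ (polylogLeft s) z := by
  have hU : IsOpen (cutRight ∩ Complex.slitPlane) := isOpen_cutRight.inter Complex.isOpen_slitPlane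
  have h1 := inv_mem_of_mem_cutLeft hz
  have h0 : z ≠ 0 := fun h => Complex.slitPlane_ne_zero h1.2 (by rw [h, inv_zero])
  have hinv : AnalyticAt ℂ (fun z : ℂ => z⁻¹) z := analyticAt_inv h0
  have hd : AnalyticAt ℂ (fun ζ => ∫ t in Set.Ioo (0 : ℝ) 1, dslope (negLogPow s) t ζ) z⁻¹ :=
    (differentiableOn_integral_dslope hU
      (fun y hy => (analyticAt_negLogPow hy).differentiableAt.differentiableWithinAt)
      (fun t ht => ofReal_mem_of_mem_Ioo ht) (integrableOn_negLogPow hs)).analyticAt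
      (hU.mem_nhds h1)
  exact analyticAt_const.mul (((AnalyticAt.fun_comp (f := fun z : ℂ => z⁻¹) hd hinv).neg).add
    ((AnalyticAt.fun_comp (f := fun z : ℂ => z⁻¹) (analyticAt_negLogPow h1) hinv).mul
      (((hinv.clog h1.2).sub ((analyticAt_const.sub hinv).clog h1.1)).add analyticAt_const)))

theorem integral_inv_sub {ζ : ℂ} (hζ : ζ.im ≠ 0) :
    IntegrableOn (fun t : ℝ => (ζ - t)⁻¹) (Set.Ioo 0 1) ∧
      ∫ t in Set.Ioo (0 : ℝ) 1, (ζ - t)⁻¹ = Complex.log ζ - Complex.log (ζ - 1) := by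
  have hmem : ∀ t : ℝ, ζ - t ∈ Complex.slitPlane := fun t =>
    Complex.mem_slitPlane_iff.2 (.inr (by simpa using hζ))
  have hcont : Continuous (fun t : ℝ => (ζ - t)⁻¹) :=
    (by fun_prop : Continuous fun t : ℝ => ζ - t).inv₀
      fun t => Complex.slitPlane_ne_zero (hmem t)
  refine ⟨(hcont.integrableOn_Icc (a := 0) (b := 1)).mono_set Set.Ioo_subset_Icc_self, ?_⟩
  rw [← integral_Ioc_eq_integral_Ioo, ← intervalIntegral.integral_of_le zero_le_one,
    intervalIntegral.integral_eq_sub_of_hasDerivAt (f := fun t : ℝ => -Complex.log (ζ - t))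
      (fun t _ => ?_) (hcont.intervalIntegrable _ _)]
  · simp
    ring
  · have h1 : HasDerivAt (fun t : ℝ => ζ - (t : ℂ)) (-1) t := by
      simpa using (Complex.ofRealCLM.hasDerivAt (x := t)).const_sub ζ
    convert! (h1.clog_real (hmem t)).neg using 1
    rw [neg_div, neg_neg, one_div]

/-- With `ζ = 1/z` the kernel is `1/(ζ - t)`. Subtracting `ψ(ζ)` from the density leaves difference
quotients plus `ψ(ζ) ∫ dt/(ζ - t)`, which isolates the multivalued part, as in the Plemelj jump
formula. -/
theorem polylogRight_eq_of_im_ne_zero {s z : ℂ} (hs : 0 < s.re) (hz : z.im ≠ 0) :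
    polylogRight s z = 1 / Complex.Gamma s *
      (-(∫ t in Set.Ioo (0 : ℝ) 1, dslope (negLogPow s) t z⁻¹) +
        negLogPow s z⁻¹ * (Complex.log z⁻¹ - Complex.log (z⁻¹ - 1))) := by
  have h0 : z ≠ 0 := fun h => hz (by simp [h])
  have him : (z⁻¹).im ≠ 0 := by
    rw [Complex.inv_im]
    exact div_ne_zero (neg_ne_zero.2 hz) (Complex.normSq_pos.2 h0).ne'
  obtain ⟨hi, hv⟩ := integral_inv_sub him
  have hne : ∀ t : ℝ, z⁻¹ - t ≠ 0 := fun t h => him (by simpa using congrArg Complex.im h)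
  have hF : ∀ t : ℝ, negLogPow s t * (z / (1 - t * z)) =
      -dslope (negLogPow s) t z⁻¹ + negLogPow s z⁻¹ * (z⁻¹ - t)⁻¹ := by
    intro t
    have h1 := hne t
    have h2 : (1 - t * z : ℂ) ≠ 0 := by
      have : (1 - t * z : ℂ) = z * (z⁻¹ - t) := by field_simp
      rw [this]
      exact mul_ne_zero h0 h1
    have h3 : z / (1 - t * z) = (z⁻¹ - t)⁻¹ := by
      rw [eq_comm, inv_eq_iff_eq_inv, inv_div]
      field_simp
    rw [dslope_of_ne' _ (sub_ne_zero.1 h1), h3]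
    ring
  have hK : IntegrableOn (fun t : ℝ => negLogPow s t * (z / (1 - t * z))) (Set.Ioo 0 1) :=
    integrableOn_mul_div (integrableOn_negLogPow hs) (mem_cutRight.2 (.inr hz))
  have hD : IntegrableOn (fun t : ℝ => dslope (negLogPow s) t z⁻¹) (Set.Ioo 0 1) := by
    refine ((hi.const_mul (negLogPow s z⁻¹)).sub hK).congr (.of_forall fun t => ?_)
    simp only [Pi.sub_apply, hF]
    ring
  rw [polylogRight, setIntegral_congr_fun measurableSet_Ioo fun t _ => hF t,
    integral_add (by exact hD.neg) (hi.const_mul _), integral_neg, integral_const_mul, hv]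

theorem polylogRight_eq_polylogLeft_of_im_pos {s z : ℂ} (hs : 0 < s.re) (hz : 0 < z.im) :
    polylogRight s z = polylogLeft s z := by
  have h0 : z ≠ 0 := fun h => hz.ne' (by simp [h])
  have him : (z⁻¹).im < 0 := by
    rw [Complex.inv_im]
    exact div_neg_of_neg_of_pos (neg_neg_of_pos hz) (Complex.normSq_pos.2 h0)
  have := Complex.log_neg_of_im_pos (z := 1 - z⁻¹) (by simpa using him)
  rw [neg_sub] at this
  rw [polylogRight_eq_of_im_ne_zero hs hz.ne', polylogLeft, this]
  ring

theorem polylogRight_eq_polylogLeft_of_im_neg {s z : ℂ} (hs : 0 < s.re) (hz : z.im < 0) :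
    polylogRight s z =
      polylogLeft s z - 2 * Real.pi * Complex.I / Complex.Gamma s * negLogPow s z⁻¹ := by
  have h0 : z ≠ 0 := fun h => hz.ne (by simp [h])
  have him : 0 < (z⁻¹).im := by
    rw [Complex.inv_im]
    exact div_pos (neg_pos.2 hz) (Complex.normSq_pos.2 h0)
  have := Complex.log_neg_of_im_neg (z := 1 - z⁻¹) (by simpa using him)
  rw [neg_sub] at this
  rw [polylogRight_eq_of_im_ne_zero hs hz.ne, polylogLeft, this]
  ring

/-! ### The class of germs stable under continuation in `ℂ ∖ {0,1}`. -/

/-- The germs at `b` of the functions `(log z) ^ (s - 1)`, for all determinations of the logarithm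
and of the power. -/
def logPowGerms (s b : ℂ) : Set (ℂ → ℂ) :=
  {h | ∃ m : ℂ → ℂ, AnalyticAt ℂ m b ∧ (∀ᶠ z in 𝓝 b, Complex.exp (Complex.exp (m z)) = z) ∧
    h = fun z => Complex.exp ((s - 1) * m z)}

/-- The class of germs `Li_s + h`, with `h` in the span of the germs of `(log z) ^ (s - 1)`. -/
def IsPolylogGerm (s b : ℂ) (f : ℂ → ℂ) : Prop :=
  (b ∈ cutRight ∧ ∃ h ∈ Submodule.span ℂ (logPowGerms s b), f =ᶠ[𝓝 b] polylogRight s + h) ∨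
    (b ∈ cutLeft ∧ ∃ h ∈ Submodule.span ℂ (logPowGerms s b), f =ᶠ[𝓝 b] polylogLeft s + h)

theorem exp_exp_log_neg_log {z : ℂ} (hz : z ∈ cutRight ∩ Complex.slitPlane) :
    Complex.exp (Complex.exp (Complex.log (-Complex.log z))) = z⁻¹ := by
  rw [Complex.exp_log (Complex.slitPlane_ne_zero (neg_log_mem_slitPlane hz)), Complex.exp_neg,
    Complex.exp_log (Complex.slitPlane_ne_zero hz.2)]

theorem ne_zero_of_mem_cutLeft {z : ℂ} (hz : z ∈ cutLeft) : z ≠ 0 := fun h =>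
  Complex.slitPlane_ne_zero (inv_mem_of_mem_cutLeft hz).2 (by rw [h, inv_zero])

theorem negLogPow_inv_mem {s b : ℂ} (hb : b ∈ cutLeft) :
    (fun z => negLogPow s z⁻¹) ∈ logPowGerms s b := by
  refine ⟨fun z => Complex.log (-Complex.log z⁻¹), ?_, ?_, rfl⟩
  · exact (analyticAt_log_neg_log (inv_mem_of_mem_cutLeft hb)).fun_comp
      (f := fun z : ℂ => z⁻¹) (analyticAt_inv (ne_zero_of_mem_cutLeft hb))
  · filter_upwards [isOpen_cutLeft.mem_nhds hb] with z hz
    rw [exp_exp_log_neg_log (inv_mem_of_mem_cutLeft hz), inv_inv]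

theorem powDet_pi (z a : ℂ) :
    powDet Real.pi z a = Complex.exp (a * (Complex.log (-z) + Real.pi * Complex.I)) := by
  rw [powDet, logDet, Complex.exp_neg, Complex.exp_pi_mul_I, inv_neg, inv_one, mul_neg_one]

theorem powDet_zero (z a : ℂ) : powDet 0 z a = Complex.exp (a * Complex.log z) := by
  simp [powDet, logDet]

theorem powDet_pi_log_mem {s b : ℂ} (hb : b ∈ cutRight ∩ Complex.slitPlane) :
    (fun z => powDet Real.pi (Complex.log z) (s - 1)) ∈ logPowGerms s b := by
  refine ⟨fun z => Complex.log (-Complex.log z) + Real.pi * Complex.I,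
    (analyticAt_log_neg_log hb).add analyticAt_const, ?_, funext fun z => powDet_pi _ _⟩
  filter_upwards [(isOpen_cutRight.inter Complex.isOpen_slitPlane).mem_nhds hb] with z hz
  rw [Complex.exp_add, Complex.exp_pi_mul_I, mul_neg_one, Complex.exp_neg, exp_exp_log_neg_log hz,
    inv_inv]

/-- For `Im z > 0` also `log z` lies in the upper half plane, where the principal determination and
the one centred at `π` agree. In the lower half plane they differ. -/
theorem negLogPow_inv_eq_powDet {s z : ℂ} (hz : 0 < z.im) :
    negLogPow s z⁻¹ = powDet Real.pi (Complex.log z) (s - 1) := by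
  have harg : z.arg ≠ Real.pi := fun h => hz.ne' (Complex.arg_eq_pi_iff.1 h).2
  have h1 : 0 < (Complex.log z).im := by
    rw [Complex.log_im]
    refine lt_of_le_of_ne (Complex.arg_nonneg_iff.2 hz.le) fun h => ?_
    exact hz.ne' (Complex.arg_eq_zero_iff.1 h.symm).2
  rw [powDet_pi, Complex.log_neg_of_im_pos h1, negLogPow, Complex.log_inv _ harg, neg_neg]
  ring_nf

/-- The two sheets coincide above the real axis and differ below it by the jump, a multiple of a
branch of `(log z)^{s-1}`. Hence a germ of the class can be written over either sheet wherever that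
sheet is defined. -/
theorem exists_mem_span_polylogRight_eq {s b : ℂ} (hs : 0 < s.re) (hb : b.im ≠ 0) :
    ∃ h ∈ Submodule.span ℂ (logPowGerms s b),
      polylogRight s =ᶠ[𝓝 b] polylogLeft s + h := by
  rcases hb.lt_or_gt with hb' | hb'
  · refine ⟨-(2 * Real.pi * Complex.I / Complex.Gamma s) • fun z => negLogPow s z⁻¹,
      Submodule.smul_mem _ _ (Submodule.subset_span (negLogPow_inv_mem
        (mem_cutLeft.2 (.inr hb)))), ?_⟩
    filter_upwards [(isOpen_Iio.preimage Complex.continuous_im).mem_nhds hb'] with z hz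
    rw [polylogRight_eq_polylogLeft_of_im_neg hs hz]
    simp [sub_eq_add_neg]
  · refine ⟨0, Submodule.zero_mem _, ?_⟩
    filter_upwards [(isOpen_Ioi.preimage Complex.continuous_im).mem_nhds hb'] with z hz
    simp [polylogRight_eq_polylogLeft_of_im_pos hs hz]

theorem IsPolylogGerm.exists_right {s b : ℂ} {f : ℂ → ℂ} (hs : 0 < s.re)
    (hf : IsPolylogGerm s b f) (hb : b ∈ cutRight) :
    ∃ h ∈ Submodule.span ℂ (logPowGerms s b), f =ᶠ[𝓝 b] polylogRight s + h := by
  rcases hf with hf | ⟨hb', h, hh, hf⟩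
  · exact hf.2
  · have him : b.im ≠ 0 := fun h0 => by
      rcases mem_cutRight.1 hb with h1 | h1
      · rcases mem_cutLeft.1 hb' with h2 | h2
        · linarith
        · exact h2 h0
      · exact h1 h0
    obtain ⟨k, hk, hfk⟩ := exists_mem_span_polylogRight_eq hs him
    refine ⟨h - k, Submodule.sub_mem _ hh hk, ?_⟩
    filter_upwards [hf, hfk] with z h1 h2
    simp only [Pi.add_apply, Pi.sub_apply] at *
    rw [h1, h2]
    ring

theorem IsPolylogGerm.exists_left {s b : ℂ} {f : ℂ → ℂ} (hs : 0 < s.re)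
    (hf : IsPolylogGerm s b f) (hb : b ∈ cutLeft) :
    ∃ h ∈ Submodule.span ℂ (logPowGerms s b), f =ᶠ[𝓝 b] polylogLeft s + h := by
  rcases hf with ⟨hb', h, hh, hf⟩ | hf
  · have him : b.im ≠ 0 := fun h0 => by
      rcases mem_cutRight.1 hb' with h1 | h1
      · rcases mem_cutLeft.1 hb with h2 | h2
        · linarith
        · exact h2 h0
      · exact h1 h0
    obtain ⟨k, hk, hfk⟩ := exists_mem_span_polylogRight_eq hs him
    refine ⟨h + k, Submodule.add_mem _ hh hk, ?_⟩
    filter_upwards [hf, hfk] with z h1 h2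
    simp only [Pi.add_apply] at *
    rw [h1, h2]
    ring
  · exact hf.2

/-- Germs in the span of the powers of logarithms extend to every disc in `ℂ ∖ {0, 1}`. -/
theorem exists_extension_of_mem_span {s a b : ℂ} {r : ℝ}
    (hball : ∀ z ∈ Metric.ball a r, z ≠ 0 ∧ z ≠ 1) (hb : b ∈ Metric.ball a r) {h : ℂ → ℂ}
    (hh : h ∈ Submodule.span ℂ (logPowGerms s b)) :
    ∃ F : ℂ → ℂ, DifferentiableOn ℂ F (Metric.ball a r) ∧ F =ᶠ[𝓝 b] h ∧
      ∀ c ∈ Metric.ball a r, F ∈ Submodule.span ℂ (logPowGerms s c) := by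
  induction hh using Submodule.span_induction with
  | mem h hh =>
    obtain ⟨m, hm, hexp, rfl⟩ := hh
    obtain ⟨L, hL, hLb, hLe⟩ := exists_exp_eq_of_differentiableOn (f := fun z => z)
      differentiableOn_id (fun z hz => (hball z hz).1) hb hexp.self_of_nhds
    -- The puncture at `1` enters here: a zero of a logarithm of `z` forces `z = 1`. So the second
    -- logarithm `M` of `L` exists.
    have hL0 : ∀ z ∈ Metric.ball a r, L z ≠ 0 := fun z hz h0 => by
      have := hLe z hz
      rw [h0, Complex.exp_zero] at this
      exact (hball z hz).2 this.symm
    obtain ⟨M, hM, hMb, hMe⟩ := exists_exp_eq_of_differentiableOn hL hL0 hb hLb.symm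
    have hnhds : ∀ c ∈ Metric.ball a r, Metric.ball a r ∈ 𝓝 c := fun c hc =>
      Metric.isOpen_ball.mem_nhds hc
    have hMan : ∀ c ∈ Metric.ball a r, AnalyticAt ℂ M c := fun c hc => hM.analyticAt (hnhds c hc)
    refine ⟨fun z => Complex.exp ((s - 1) * M z), by fun_prop, ?_, fun c hc =>
      Submodule.subset_span ⟨M, hMan c hc, ?_, rfl⟩⟩
    · have h1 : L =ᶠ[𝓝 b] fun z => Complex.exp (m z) := by
        refine eventuallyEq_of_exp_eventuallyEq (hL.analyticAt (hnhds b hb)).continuousAt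
          hm.cexp.continuousAt ?_ hLb
        filter_upwards [hexp, hnhds b hb] with z h1 h2
        rw [h1, hLe z h2]
      have h2 : M =ᶠ[𝓝 b] m := by
        refine eventuallyEq_of_exp_eventuallyEq (hMan b hb).continuousAt
          hm.continuousAt ?_ hMb
        filter_upwards [h1, hnhds b hb] with z h1 h2
        rw [hMe z h2, h1]
      filter_upwards [h2] with z hz
      rw [hz]
    · filter_upwards [hnhds c hc] with z hz
      rw [hMe z hz, hLe z hz]
  | zero => exact ⟨0, differentiableOn_const _, .rfl, fun c _ => Submodule.zero_mem _⟩
  | add h₁ h₂ _ _ ih₁ ih₂ =>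
    obtain ⟨F₁, d₁, e₁, s₁⟩ := ih₁
    obtain ⟨F₂, d₂, e₂, s₂⟩ := ih₂
    exact ⟨F₁ + F₂, d₁.add d₂, e₁.add e₂, fun c hc => Submodule.add_mem _ (s₁ c hc) (s₂ c hc)⟩
  | smul k h _ ih =>
    obtain ⟨F, d, e, s⟩ := ih
    exact ⟨k • F, d.const_smul k, e.const_smul k, fun c hc => Submodule.smul_mem _ _ (s c hc)⟩

theorem extendsLocally_isPolylogGerm {s : ℂ} (hs : 0 < s.re) :
    ExtendsLocally (IsPolylogGerm s) {z | z ≠ 0 ∧ z ≠ 1} := by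
  intro a ha
  have hopen : IsOpen {z : ℂ | z ≠ 0 ∧ z ≠ 1} :=
    isOpen_compl_singleton.inter isOpen_compl_singleton
  rcases mem_cutRight_or_mem_cutLeft ha.2 with hc | hc
  · obtain ⟨r, hr, hball⟩ := Metric.isOpen_iff.1 (hopen.inter isOpen_cutRight) a ⟨ha, hc⟩
    refine ⟨r, hr, fun b hb f hf => ?_⟩
    obtain ⟨h, hh, hfh⟩ := hf.exists_right hs (hball hb).2
    obtain ⟨F, hF, hFh, hFs⟩ := exists_extension_of_mem_span (fun z hz => (hball hz).1) hb hh
    refine ⟨polylogRight s + F, DifferentiableOn.add (fun z hz => (analyticAt_polylogRight hs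
      (hball hz).2).differentiableAt.differentiableWithinAt) hF, ?_, fun c hc =>
      .inl ⟨(hball hc).2, F, hFs c hc, .rfl⟩⟩
    exact (Filter.EventuallyEq.rfl.add hFh).trans hfh.symm
  · obtain ⟨r, hr, hball⟩ := Metric.isOpen_iff.1 (hopen.inter isOpen_cutLeft) a ⟨ha, hc⟩
    refine ⟨r, hr, fun b hb f hf => ?_⟩
    obtain ⟨h, hh, hfh⟩ := hf.exists_left hs (hball hb).2
    obtain ⟨F, hF, hFh, hFs⟩ := exists_extension_of_mem_span (fun z hz => (hball hz).1) hb hh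
    refine ⟨polylogLeft s + F, DifferentiableOn.add (fun z hz => (analyticAt_polylogLeft hs
      (hball hz).2).differentiableAt.differentiableWithinAt) hF, ?_, fun c hc =>
      .inr ⟨(hball hc).2, F, hFs c hc, .rfl⟩⟩
    exact (Filter.EventuallyEq.rfl.add hFh).trans hfh.symm

theorem polylogRight_eventuallyEq_polylog {s w : ℂ} (hs : 0 < s.re) (hw : ‖w‖ < 1) :
    polylogRight s =ᶠ[𝓝 w] polylog s := by
  filter_upwards [(isOpen_Iio.preimage continuous_norm).mem_nhds hw] with z hz
  exact polylogRight_eq_polylog hs hz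

theorem IsLoopAboutOne.exists_continuation_polylog {s : ℂ} (hs : 0 < s.re) {w : ℂ} (hw : ‖w‖ < 1)
    (hw' : w ∈ Complex.slitPlane) {γ : Path w w} (hloop : IsLoopAboutOne γ) :
    ∃ g, IsAnalyticContinuationAlong γ g ∧ g 0 =ᶠ[𝓝 w] polylog s ∧
      g 1 =ᶠ[𝓝 w] fun z => polylog s z -
        2 * Real.pi * Complex.I / Complex.Gamma s * powDet Real.pi (Complex.log z) (s - 1) := by
  obtain ⟨ε, hε, H, hH⟩ := hloop
  set κ : ℂ := 2 * Real.pi * Complex.I / Complex.Gamma s with hκ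
  -- `F₂` continues `polylogRight` from the lower half plane across `(1,∞)`, and `F₃` continues `F₂`
  -- from the upper half plane. The branch is then changed from `negLogPow s z⁻¹` to `powDet
  -- Real.pi`, which is holomorphic across `(0,1)`.
  set F₂ : ℂ → ℂ := fun z => polylogLeft s z - κ * negLogPow s z⁻¹ with hF₂
  set F₃ : ℂ → ℂ := fun z => polylogRight s z - κ * powDet Real.pi (Complex.log z) (s - 1) with hF₃
  have han : ∀ {b : ℂ} {h : ℂ → ℂ}, h ∈ logPowGerms s b → AnalyticAt ℂ h b := by
    rintro b _ ⟨m, hm, -, rfl⟩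
    exact (analyticAt_const.mul hm).cexp
  have h1 : ∀ z ∈ cutRight ∩ Complex.slitPlane, IsPolylogGerm s z (polylogRight s) := fun z hz =>
    .inl ⟨hz.1, 0, Submodule.zero_mem _, by rw [add_zero]⟩
  have h2 : ∀ z ∈ cutLeft, IsPolylogGerm s z F₂ := fun z hz =>
    .inr ⟨hz, (-κ) • fun z => negLogPow s z⁻¹,
      Submodule.smul_mem _ _ (Submodule.subset_span (negLogPow_inv_mem hz)),
      .of_forall fun y => by simp [hF₂, sub_eq_add_neg]⟩
  have h3 : ∀ z ∈ cutRight ∩ Complex.slitPlane, IsPolylogGerm s z F₃ := fun z hz =>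
    .inl ⟨hz.1, (-κ) • fun z => powDet Real.pi (Complex.log z) (s - 1),
      Submodule.smul_mem _ _ (Submodule.subset_span (powDet_pi_log_mem hz)),
      .of_forall fun y => by simp [hF₃, sub_eq_add_neg]⟩
  have h12 : ∀ z : ℂ, z.im < 0 → polylogRight s z = F₂ z := fun z hz =>
    polylogRight_eq_polylogLeft_of_im_neg hs hz
  have h23 : ∀ z : ℂ, 0 < z.im → F₂ z = F₃ z := fun z hz => by
    simp only [hF₂, hF₃, polylogRight_eq_polylogLeft_of_im_pos hs hz, negLogPow_inv_eq_powDet hz]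
  obtain ⟨g, hg, -, h0, h1'⟩ :=
    (extendsLocally_isPolylogGerm hs).exists_continuation_of_homotopy H hH
      (isAnalyticContinuationAlong_threePieces hw hw' hε
        (fun z hz => analyticAt_polylogRight hs hz.1)
        (fun z hz => (analyticAt_polylogLeft hs hz).sub
          (analyticAt_const.mul (han (negLogPow_inv_mem hz))))
        (fun z hz => (analyticAt_polylogRight hs hz.1).sub
          (analyticAt_const.mul (han (powDet_pi_log_mem hz)))) h12 h23)
      (threePieces_induction hw hw' hε h1 h2 h3)
  rw [threePieces_zero] at h0
  rw [threePieces_one] at h1'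
  have hpoly := polylogRight_eventuallyEq_polylog hs hw
  refine ⟨g, hg, h0.trans hpoly, h1'.trans ?_⟩
  exact hpoly.sub .rfl

/-! ### Integrals along straight segments and conclusion. -/

theorem curveIntegralFun_formDlog_segment {z : ℂ} (hz : z ≠ 0) {t : ℝ}
    (ht : t ∈ Set.Icc (0 : ℝ) 1) :
    curveIntegralFun formDlog (Path.segment 0 z) t = ((t⁻¹ : ℝ) : ℂ) := by
  rw [curveIntegralFun_segment _ _ _ ht]
  have h : AffineMap.lineMap 0 z t = (t : ℂ) * z := by simp [AffineMap.lineMap_apply_module']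
  rw [h, formDlog, sub_zero, mul_inv]
  simp [hz]

theorem curveIntegralFun_formOne_segment (z : ℂ) {t : ℝ} (ht : t ∈ Set.Icc (0 : ℝ) 1) :
    curveIntegralFun formOne (Path.segment 0 z) t = z / (1 - t * z) := by
  rw [curveIntegralFun_segment _ _ _ ht]
  have h : AffineMap.lineMap 0 z t = (t : ℂ) * z := by simp [AffineMap.lineMap_apply_module']
  rw [h, formOne, sub_zero, div_eq_inv_mul]
  simp

theorem integral_formDlog_segment {z : ℂ} (hz : z ≠ 0) {t : ℝ} (ht : t ∈ Set.Ioo (0 : ℝ) 1) :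
    IntervalIntegrable (curveIntegralFun formDlog (Path.segment 0 z)) volume t 1 ∧
      ∫ u in t..1, curveIntegralFun formDlog (Path.segment 0 z) u = -Complex.log t := by
  have hcongr : ∀ u ∈ Set.uIcc t 1,
      curveIntegralFun formDlog (Path.segment 0 z) u = ((u⁻¹ : ℝ) : ℂ) := fun u hu => by
    rw [Set.uIcc_of_le ht.2.le] at hu
    exact curveIntegralFun_formDlog_segment hz ⟨ht.1.le.trans hu.1, hu.2⟩
  have hint : IntervalIntegrable (fun u : ℝ => ((u⁻¹ : ℝ) : ℂ)) volume t 1 := by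
    refine ContinuousOn.intervalIntegrable_of_Icc ht.2.le ?_
    refine Complex.continuous_ofReal.comp_continuousOn (continuousOn_inv₀.mono fun u hu => ?_)
    exact (ht.1.trans_le hu.1).ne'
  constructor
  · refine hint.congr fun u hu => (hcongr u (Set.uIoc_subset_uIcc hu)).symm
  · rw [intervalIntegral.integral_congr hcongr, intervalIntegral.integral_ofReal,
      integral_inv_of_pos ht.1 one_pos, one_div, Real.log_inv, Complex.ofReal_neg,
      Complex.ofReal_log ht.1.le]

/-- Along `[0 → z]` the form `dx/x` pulls back to `dt/t`, independently of `z`, and `dx/(1-x)` to `z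
dt/(1 - tz)`. The iterated integral is thus the integral representation itself. -/
theorem iterIntegral_segment_zero {s z : ℂ} (hs : 0 < s.re) (hz : z ≠ 0) (hz' : z ∈ cutRight) :
    IterIntegrable 0 formOne formDlog (Path.segment 0 z) s ∧
      iterIntegral 0 formOne formDlog (Path.segment 0 z) s = polylogRight s z := by
  have hcongr : ∀ t ∈ Set.Ioo (0 : ℝ) 1, iterIntegrand 0 formOne formDlog (Path.segment 0 z) s t =
      1 / Complex.Gamma s * (negLogPow s t * (z / (1 - t * z))) := fun t ht => by
    rw [iterIntegrand, (integral_formDlog_segment hz ht).2,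
      curveIntegralFun_formOne_segment z ⟨ht.1.le, ht.2.le⟩, powDet_zero, negLogPow, mul_assoc]
  have hint := (integrableOn_mul_div (integrableOn_negLogPow hs) hz').const_mul
    (1 / Complex.Gamma s)
  refine ⟨⟨fun t ht => (integral_formDlog_segment hz ht).1, ?_⟩, ?_⟩
  · rw [intervalIntegrable_iff_integrableOn_Ioo_of_le zero_le_one]
    exact IntegrableOn.congr_fun hint (fun t ht => (hcongr t ht).symm) measurableSet_Ioo
  · rw [iterIntegral, intervalIntegral.integral_of_le zero_le_one, integral_Ioc_eq_integral_Ioo,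
      setIntegral_congr_fun measurableSet_Ioo hcongr, integral_const_mul, polylogRight]

/-- The slit plane is star-shaped about `1`, so the principal logarithm is a primitive along the
segment. -/
theorem curveIntegral_formDlog_segment_one {z : ℂ} (hz : z ∈ Complex.slitPlane) :
    CurveIntegrable formDlog (Path.segment 1 z) ∧
      curveIntegral formDlog (Path.segment 1 z) = Complex.log z := by
  have hmem : ∀ t ∈ Set.Icc (0 : ℝ) 1, (t * (z - 1) + 1 : ℂ) ∈ Complex.slitPlane := by
    intro t ht
    have := Complex.starConvex_one_slitPlane hz (sub_nonneg.2 ht.2) ht.1 (by ring)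
    convert this using 1
    simp only [Complex.real_smul]
    push_cast
    ring
  have hfun : ∀ t : ℝ, formDlog (AffineMap.lineMap 1 z t) (z - 1) =
      (z - 1) / (t * (z - 1) + 1) := fun t => by
    have h : AffineMap.lineMap 1 z t = (t : ℂ) * (z - 1) + 1 := by
      simp [AffineMap.lineMap_apply_module']
    rw [h, formDlog, div_eq_inv_mul]
    simp
  have hint : IntervalIntegrable (fun t : ℝ => (z - 1) / (t * (z - 1) + 1)) volume 0 1 := by
    refine ContinuousOn.intervalIntegrable_of_Icc zero_le_one ?_
    exact continuousOn_const.div (by fun_prop) fun t ht => Complex.slitPlane_ne_zero (hmem t ht)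
  rw [curveIntegrable_segment, curveIntegral_segment]
  simp only [hfun]
  refine ⟨hint, ?_⟩
  rw [intervalIntegral.integral_eq_sub_of_hasDerivAt
    (f := fun t : ℝ => Complex.log (t * (z - 1) + 1)) (fun t ht => ?_) hint]
  · simp
  · rw [Set.uIcc_of_le zero_le_one] at ht
    have h1 : HasDerivAt (fun t : ℝ => (t : ℂ) * (z - 1) + 1) (z - 1) t := by
      simpa using ((Complex.ofRealCLM.hasDerivAt (x := t)).mul_const (z - 1)).add_const 1
    exact h1.clog_real (hmem t ht)

theorem mainTheorem5 (s : ℂ) (hs : 1 < s.re) (w : ℂ) (hw : ‖w‖ < 1) (hw' : w ∈ Complex.slitPlane)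
    (γ : Path w w) (hγ : IsPiecewiseC1 γ) (hloop : IsLoopAboutOne γ) :
    (∃ g : I → ℂ → ℂ, IsAnalyticContinuationAlong γ g ∧ g 0 =ᶠ[𝓝 w] polylog s) ∧
    (∀ g : I → ℂ → ℂ, IsAnalyticContinuationAlong γ g → g 0 =ᶠ[𝓝 w] polylog s →
      g 1 =ᶠ[𝓝 w] fun z => polylog s z -
        2 * Real.pi * Complex.I / Complex.Gamma s * powDet Real.pi (Complex.log z) (s - 1)) ∧
    CurveIntegrable formOne γ ∧
    ∀ z : ℂ, ‖z‖ < 1 → z ∈ Complex.slitPlane →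
      IterIntegrable 0 formOne formDlog (Path.segment 0 z) s ∧
      CurveIntegrable formDlog (Path.segment 1 z) ∧
      polylog s z -
          2 * Real.pi * Complex.I / Complex.Gamma s * powDet Real.pi (Complex.log z) (s - 1) =
        iterIntegral 0 formOne formDlog (Path.segment 0 z) s +
          curveIntegral formOne γ * powIntegral Real.pi formDlog (Path.segment 1 z) s := by
  have hs0 : 0 < s.re := by linarith
  obtain ⟨g₀, hg₀, h0, h1⟩ := hloop.exists_continuation_polylog hs0 hw hw'
  refine ⟨⟨g₀, hg₀, h0⟩, fun g hg hg0 => ?_, hloop.curveIntegrable_formOne hγ,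
    fun z hz hz' => ?_⟩
  · have := hg.eventuallyEq hg₀ (hg0.trans h0.symm) 1
    rw [γ.target] at this
    exact this.trans h1
  · obtain ⟨hi, hv⟩ := iterIntegral_segment_zero hs0 (Complex.slitPlane_ne_zero hz')
      (mem_cutRight_of_norm_lt_one hz)
    obtain ⟨hi', hv'⟩ := curveIntegral_formDlog_segment_one hz'
    refine ⟨hi, hi', ?_⟩
    -- The loop integral `-2πi` times `(log z)^{s-1} / Γ(s)` is exactly the monodromy term.
    rw [hv, polylogRight_eq_polylog hs0 hz, powIntegral, hv', hloop.curveIntegral_formOne hw hw' hγ]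
    ring
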